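/- **Definitions.** A Borel probability measure $\mu$ on $\mathbb R$ and a countable set $\Lambda\subset\mathbb R$ form a *spectral pair* $(\mu,\Lambda)$ if $\{e^{2\pi i\lambda x}:\lambda\in\Lambda\}$ is an orthonormal basis of $L^2(\mu)$. A real number $t$ is a *spectral eigenvalue* of the spectral pair $(\mu,\Lambda)$ if $(\mu,t\Lambda)$ is also a spectral pair. Let $N\ge 2$ be an integer and let $B,L\subset\mathbb Z$ be finite sets with $\#B=\#L\ge 2$; $(N,B,L)$ is a *Hadamard triple* if the matrix $\big(\tfrac1{\sqrt{\#B}}e^{2\pi i b\ell/N}\big)_{b\in B,\ell\in L}$ is unitary. Write $\tau_c(x)=(x+c)/N$, let $\mu_{N,B}$ be the unique Borel probability measure with $\mu=\frac1{\#B}\sum_{b\in B}\mu\circ\tau_b^{-1}$, and let $m_B(x)=\frac1{\#B}\sum_{b\in B}e^{2\pi i bx}$. If moreover $0\in B\cap L$, an *$m_B$-cycle* is a finite set $C=\{x_1,\dots,x_k\}$ ($k\ge1$) with $|m_B(x_j)|=1$ for all $j$ for which there are $\ell_1,\dots,\ell_k\in L$ such that $\tau_{\ell_j}(x_j)=x_{j+1}$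 for $1\le j<k$ and $\tau_{\ell_k}(x_k)=x_1$. Let $\Lambda$ be the smallest subset of $\mathbb R$ that contains $-C$ for every $m_B$-cycle $C$ and satisfies $N\Lambda+L\subset\Lambda$. Then $(\mu_{N,B},\Lambda)$ is a spectral pair, called the *canonical spectral pair* generated by $(N,B,L)$. **Artin's primitive root conjecture.** For every integer $a\ge2$ that is not a perfect square there are infinitely many primes $p\nmid a$ such that the order of $a$ modulo $p$ is $p-1$. **Elliott–Halberstam conjecture.** For all $0<\theta<1$ and $A>0$ there is a constant $C>0$ such that $$\sum_{1\le q\le x^\theta}\ \max_{y\le x}\ \max_{\gcd(a,q)=1}\Big|\pi(y;q,a)-\frac{\pi(y)}{\varphi(q)}\Big|\le\frac{Cx}{(\log x)^A}\qquad\text{for all }x>2,$$ where $\pi(y)$ is the number of primes $p\le y$, $\pi(y;q,a)$ is the number of primes $p\le y$ with $p\equiv a \pmod q$, and $\varphi$ is Euler's totient function. **Theorem 2.** Assume Artin's primitive root conjecture or the Elliott–Halberstam conjecture. Let $(N,B,L)$ be a Hadamard triple in $\mathbb R$ with $0\in B\cap L$, and let $(\mu_{N,B},\Lambda)$ be the canonical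 spectral pair generated by it. Then $\mu_{N,B}$ is singular continuous (it has no atoms and is singular with respect to Lebesgue measure) if and only if $\#B<N$; and if $\mu_{N,B}$ is singular continuous, then there are infinitely many primes $p$ that are spectral eigenvalues of $(\mu_{N,B},\Lambda)$. -/

import Mathlib

open MeasureTheory

/-! ### Hadamard triples and self-similar measures -/

/-- The map `τ_c(x) = (x + c) / N` of the iterated function systems attached to `N`. -/
noncomputable def ifsMap (N : ℕ) (c : ℤ) (x : ℝ) : ℝ := (x + c) / N

/-- The matrix `((#B)^{-1/2} e^{2πi bℓ/N})`, with rows `b ∈ B` and columns `ℓ ∈ L`. -/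
noncomputable def hadamardMatrix (N : ℕ) (B L : Finset ℤ) : Matrix B L ℂ :=
  fun b l => ((1 / Real.sqrt (B.card : ℝ) : ℝ) : ℂ) *
    Complex.exp (2 * Real.pi * Complex.I * ((b : ℤ) * (l : ℤ) / N))

/-- `(N, B, L)` is a Hadamard triple in `ℝ`. -/
structure IsHadamardTriple (N : ℕ) (B L : Finset ℤ) : Prop where
  two_le : 2 ≤ N
  card_eq : B.card = L.card
  two_le_card : 2 ≤ B.card
  mul_conjTranspose : hadamardMatrix N B L * (hadamardMatrix N B L).conjTranspose = 1
  conjTranspose_mul : (hadamardMatrix N B L).conjTranspose * hadamardMatrix N B L = 1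

/-- `μ` is a Borel probability measure with `μ = (#B)⁻¹ ∑_{b ∈ B} μ ∘ τ_b⁻¹`. -/
def IsSelfSimilarMeasure (N : ℕ) (B : Finset ℤ) (μ : Measure ℝ) : Prop :=
  IsProbabilityMeasure μ ∧ μ = (B.card : ENNReal)⁻¹ • ∑ b ∈ B, μ.map (ifsMap N b)

theorem measurable_ifsMap (N : ℕ) (c : ℤ) : Measurable (ifsMap N c) := by
  unfold ifsMap; fun_prop

theorem exists_isSelfSimilarMeasure (N : ℕ) (hN : 2 ≤ N) (B : Finset ℤ) (hB : B.Nonempty) :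
    ∃ μ : Measure ℝ, IsSelfSimilarMeasure N B μ := by
  classical
  have hB0 : (B.card : ENNReal) ≠ 0 := by simpa using hB.ne_empty
  have hBt : (B.card : ENNReal) ≠ ⊤ := by simp
  have hN0 : (N : ℝ) ≠ 0 := by positivity
  let Q : Measure B := (B.card : ENNReal)⁻¹ • Measure.count
  have hQ : IsProbabilityMeasure Q := ⟨by
    simp [Q, ENNReal.inv_mul_cancel hB0 hBt]⟩
  let P : Measure (ℕ → B) := Measure.infinitePi fun _ => Q
  let X : (ℕ → B) → ℝ := fun ω => ∑' k, ((ω k : ℤ) : ℝ) * ((N : ℝ)⁻¹) ^ (k + 1)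
  obtain ⟨M, hM⟩ : ∃ M : ℝ, ∀ b : B, ‖((b : ℤ) : ℝ)‖ ≤ M := by
    obtain ⟨M, hM⟩ := (Set.finite_range fun b : B => ‖((b : ℤ) : ℝ)‖).bddAbove
    exact ⟨M, fun b => hM ⟨b, rfl⟩⟩
  have hgeo : Summable fun k : ℕ => M * ((N : ℝ)⁻¹) ^ (k + 1) := by
    have h1 : ((N : ℝ)⁻¹) < 1 := inv_lt_one_of_one_lt₀ (by exact_mod_cast hN)
    exact (((summable_nat_add_iff 1).2
      (summable_geometric_of_lt_one (by positivity) h1))).mul_left M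
  have hbd : ∀ (k : ℕ) (ω : ℕ → B),
      ‖((ω k : ℤ) : ℝ) * ((N : ℝ)⁻¹) ^ (k + 1)‖ ≤ M * ((N : ℝ)⁻¹) ^ (k + 1) := by
    intro k ω
    rw [norm_mul, norm_pow, norm_inv, Real.norm_natCast]
    gcongr
    exact hM _
  have hsum : ∀ ω : ℕ → B, Summable fun k => ((ω k : ℤ) : ℝ) * ((N : ℝ)⁻¹) ^ (k + 1) :=
    fun ω => Summable.of_norm_bounded hgeo fun k => hbd k ω
  have hXc : Continuous X := by
    refine continuous_tsum (fun k => ?_) hgeo hbd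
    have : Continuous fun b : B => ((b : ℤ) : ℝ) := continuous_of_discreteTopology
    exact (this.comp (continuous_apply k)).mul continuous_const
  have hXm : Measurable X := hXc.measurable
  let c : B × (ℕ → B) → (ℕ → B) := fun z k => Nat.casesOn k z.1 z.2
  have hcm : Measurable c := by
    refine measurable_pi_lambda _ fun k => ?_
    cases k with
    | zero => exact measurable_fst
    | succ k => exact (measurable_pi_apply k).comp measurable_snd
  have hXcons : ∀ z, X (c z) = ifsMap N (z.1 : ℤ) (X z.2) := by
    intro z
    have h := (hsum (c z)).tsum_eq_zero_add
    simp only [X, ifsMap]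
    rw [h, add_div, ← tsum_div_const, add_comm]
    congr 1
    · refine tsum_congr fun k => ?_
      simp only [c]
      rw [pow_succ _ (k + 1)]
      field_simp
    · simp [c, div_eq_mul_inv]
  have hPc : (Q.prod P).map c = P := by
    refine Measure.eq_infinitePi _ fun s t ht => ?_
    rw [Measure.map_apply hcm (MeasurableSet.pi s.countable_toSet fun i _ => ht i)]
    let t' : ℕ → Set B := fun i => if i ∈ s then t i else Set.univ
    obtain ⟨n, hn⟩ : ∃ n, s ⊆ Finset.range (n + 1) := by
      obtain ⟨n, hn⟩ := s.exists_nat_subset_range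
      exact ⟨n, hn.trans (Finset.range_mono (Nat.le_succ n))⟩
    have hset : c ⁻¹' (Set.pi s t)
        = t' 0 ×ˢ Set.pi (Finset.range n : Finset ℕ) fun i => t' (i + 1) := by
      ext z
      simp only [Set.mem_preimage, Set.mem_pi, Finset.mem_coe, Set.mem_prod, Finset.mem_range]
      constructor
      · intro h
        refine ⟨?_, fun i _ => ?_⟩
        · by_cases h0 : 0 ∈ s
          · simpa [t', h0, c] using h 0 h0
          · simp [t', h0]
        · by_cases h0 : i + 1 ∈ s
          · simpa [t', h0] using h (i + 1) h0
          · simp [t', h0]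
      · rintro ⟨h0, h1⟩ i hi
        cases i with
        | zero => simpa [t', hi, c] using h0
        | succ i =>
          have : i < n := by simpa using hn hi
          simpa [t', hi] using h1 i this
    have ht' : ∀ i, MeasurableSet (t' i) := fun i => by
      by_cases h : i ∈ s
      · simpa [t', h] using ht i
      · simp [t', h]
    rw [hset, Measure.prod_prod, Measure.infinitePi_pi _ fun i _ => ht' (i + 1), mul_comm,
      ← Finset.prod_range_succ' (fun i => Q (t' i)) n]
    rw [← Finset.prod_subset hn]
    · exact Finset.prod_congr rfl fun i hi => by simp [t', hi]
    · intro i _ hi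
      simp [t', hi]
  refine ⟨P.map X, Measure.isProbabilityMeasure_map hXm.aemeasurable, ?_⟩
  ext S hS
  rw [Measure.map_apply hXm hS]
  conv_lhs => rw [← hPc]
  rw [Measure.map_apply hcm (hXm hS), Measure.prod_apply (hcm (hXm hS))]
  simp only [Q, lintegral_smul_measure, lintegral_count, tsum_fintype, Measure.smul_apply,
    Measure.finsetSum_apply]
  rw [← Finset.sum_coe_sort B]
  congr 1
  refine Finset.sum_congr rfl fun b _ => ?_
  rw [Measure.map_apply (measurable_ifsMap N b) hS,
    Measure.map_apply hXm (measurable_ifsMap N b hS)]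
  congr 1
  ext ω
  simp [hXcons]

theorem IsSelfSimilarMeasure.charFun_eq {N : ℕ} {B : Finset ℤ} {μ : Measure ℝ}
    (h : IsSelfSimilarMeasure N B μ) (t : ℝ) :
    charFun μ t = (B.card : ℂ)⁻¹ *
      ∑ b ∈ B, Complex.exp (t * (b / N) * Complex.I) * charFun μ (t / N) := by
  have := h.1
  have hi : ∀ b ∈ B, Integrable (fun x : ℝ => Complex.exp (t * x * Complex.I))
      (μ.map (ifsMap N b)) := by
    intro b _
    have := Measure.isProbabilityMeasure_map (μ := μ) (measurable_ifsMap N b).aemeasurable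
    refine (integrable_const (1 : ℝ)).mono' (by fun_prop) (Filter.Eventually.of_forall fun x => ?_)
    rw [← Complex.ofReal_mul, Complex.norm_exp_ofReal_mul_I]
  have key : ∫ x, Complex.exp (t * x * Complex.I) ∂μ
      = ∫ x, Complex.exp (t * x * Complex.I)
        ∂((B.card : ENNReal)⁻¹ • ∑ b ∈ B, μ.map (ifsMap N b)) := by
    rw [← h.2]
  rw [charFun_apply_real, key, integral_smul_measure, integral_finsetSum_measure hi]
  rw [ENNReal.toReal_inv, ENNReal.toReal_natCast, Complex.real_smul]
  push_cast
  congr 1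
  refine Finset.sum_congr rfl fun b _ => ?_
  rw [integral_map (measurable_ifsMap N b).aemeasurable (by fun_prop), charFun_apply_real,
    ← integral_const_mul]
  refine integral_congr_ae (Filter.Eventually.of_forall fun x => ?_)
  simp only [ifsMap]
  rw [← Complex.exp_add]
  congr 1
  push_cast
  ring

theorem IsSelfSimilarMeasure.unique {N : ℕ} (hN : 2 ≤ N) {B : Finset ℤ} {μ ν : Measure ℝ}
    (hμ : IsSelfSimilarMeasure N B μ) (hν : IsSelfSimilarMeasure N B ν) : μ = ν := by
  have := hμ.1
  have := hν.1
  have step : ∀ t : ℝ, ‖charFun μ t - charFun ν t‖ ≤ ‖charFun μ (t / N) - charFun ν (t / N)‖ := by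
    intro t
    rw [hμ.charFun_eq t, hν.charFun_eq t, ← mul_sub, ← Finset.sum_sub_distrib, norm_mul]
    have h1 : ‖∑ b ∈ B, (Complex.exp (t * (b / N) * Complex.I) * charFun μ (t / N)
        - Complex.exp (t * (b / N) * Complex.I) * charFun ν (t / N))‖
        ≤ ∑ b ∈ B, ‖charFun μ (t / N) - charFun ν (t / N)‖ := by
      refine norm_sum_le_of_le _ fun b _ => ?_
      rw [← mul_sub, norm_mul]
      have : ‖Complex.exp (t * (b / N) * Complex.I)‖ = 1 := by
        have := Complex.norm_exp_ofReal_mul_I (t * (b / N))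
        push_cast at this
        exact this
      rw [this, one_mul]
    rw [Finset.sum_const, nsmul_eq_mul] at h1
    rw [norm_inv, Complex.norm_natCast]
    refine (mul_le_mul_of_nonneg_left h1 (by positivity)).trans ?_
    rw [← mul_assoc]
    exact mul_le_of_le_one_left (norm_nonneg _) inv_mul_le_one
  have iter : ∀ (n : ℕ) (t : ℝ), ‖charFun μ t - charFun ν t‖
      ≤ ‖charFun μ (t / (N : ℝ) ^ n) - charFun ν (t / (N : ℝ) ^ n)‖ := by
    intro n t
    induction n with
    | zero => simp
    | succ n ih =>
      refine ih.trans ((step _).trans (le_of_eq ?_))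
      rw [div_div, ← pow_succ]
  refine Measure.ext_of_charFun (funext fun t => ?_)
  have hlim : Filter.Tendsto (fun n : ℕ => t / (N : ℝ) ^ n) Filter.atTop (nhds 0) :=
    (tendsto_pow_atTop_atTop_of_one_lt (by exact_mod_cast hN)).const_div_atTop t
  have hc : Continuous fun t : ℝ => ‖charFun μ t - charFun ν t‖ :=
    (continuous_charFun.sub continuous_charFun).norm
  have h0 := (hc.tendsto 0).comp hlim
  simp only [charFun_zero, probReal_univ, sub_self, norm_zero] at h0
  have := ge_of_tendsto' h0 fun n => iter n t
  exact sub_eq_zero.1 (norm_le_zero_iff.1 this)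

open Classical in
/-- The self-similar measure `μ_{N,B}`: the unique measure with `IsSelfSimilarMeasure N B`, which
exists as soon as `2 ≤ N` and `B` is non-empty (and `0` otherwise). -/
noncomputable def selfSimilarMeasure (N : ℕ) (B : Finset ℤ) : Measure ℝ :=
  if h : ∃ μ : Measure ℝ, IsSelfSimilarMeasure N B μ then h.choose else 0

theorem isSelfSimilarMeasure_iff {N : ℕ} (hN : 2 ≤ N) {B : Finset ℤ} (hB : B.Nonempty)
    (μ : Measure ℝ) : IsSelfSimilarMeasure N B μ ↔ μ = selfSimilarMeasure N B := by
  have hex := exists_isSelfSimilarMeasure N hN B hB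
  have h : IsSelfSimilarMeasure N B (selfSimilarMeasure N B) := by
    rw [selfSimilarMeasure, dif_pos hex]
    exact hex.choose_spec
  exact ⟨fun hμ => hμ.unique hN h, fun hμ => hμ ▸ h⟩

/-! ### The canonical spectrum -/

/-- `m_B(x) = (#B)⁻¹ ∑_{b ∈ B} e^{2πi b x}`. -/
noncomputable def maskFun (B : Finset ℤ) (x : ℝ) : ℂ :=
  (B.card : ℂ)⁻¹ * ∑ b ∈ B, Complex.exp (2 * Real.pi * Complex.I * (b * x))

/-- `C = {x_0, …, x_k}` with `τ_{ℓ_j}(x_j) = x_{j+1}` for digits `ℓ_j ∈ L`, the indices being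
read modulo `k + 1` (addition in `Fin (k + 1)` is cyclic), and `|m_B| = 1` on `C`. -/
def IsExtremeCycle (N : ℕ) (B L : Finset ℤ) (C : Set ℝ) : Prop :=
  ∃ (k : ℕ) (x : Fin (k + 1) → ℝ) (l : Fin (k + 1) → ℤ),
    C = Set.range x ∧ (∀ j, l j ∈ L) ∧ (∀ j, ifsMap N (l j) (x j) = x (j + 1)) ∧
      ∀ j, ‖maskFun B (x j)‖ = 1

/-- The smallest set that contains `-C` for all extreme cycles `C` and is stable under
`s ↦ N s + ℓ` for `ℓ ∈ L`. -/
def canonicalSpectrum (N : ℕ) (B L : Finset ℤ) : Set ℝ :=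
  ⋂₀ {S : Set ℝ | (∀ C, IsExtremeCycle N B L C → ∀ x ∈ C, -x ∈ S) ∧
    ∀ s ∈ S, ∀ l ∈ L, (N : ℝ) * s + (l : ℝ) ∈ S}

/-! ### Spectral pairs -/

/-- `(μ, Λ)` is a spectral pair: `μ` is a Borel probability measure, `Λ` is countable, and the
exponentials `e^{2πi λ x}`, `λ ∈ Λ`, form an orthonormal (Hilbert) basis of `L²(μ)`. -/
def IsSpectralPair (μ : Measure ℝ) (Λ : Set ℝ) : Prop :=
  IsProbabilityMeasure μ ∧ Λ.Countable ∧
    ∃ e : HilbertBasis Λ ℂ (Lp ℂ 2 μ), ∀ l : Λ,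
      (e l : ℝ → ℂ) =ᵐ[μ] fun x => Complex.exp (2 * Real.pi * Complex.I * ((l : ℝ) * x))

/-- `t` is a spectral eigenvalue of the spectral pair `(μ, Λ)`: both `(μ, Λ)` and `(μ, tΛ)` are
spectral pairs. -/
def IsSpectralEigenvalue (μ : Measure ℝ) (Λ : Set ℝ) (t : ℝ) : Prop :=
  IsSpectralPair μ Λ ∧ IsSpectralPair μ ((fun l => t * l) '' Λ)

/-- `μ` has no atoms and is singular with respect to Lebesgue measure. -/
def IsSingularContinuous (μ : Measure ℝ) : Prop :=
  (∀ x : ℝ, μ {x} = 0) ∧ μ ⟂ₘ (volume : Measure ℝ)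

/-! ### The two conjectures -/

/-- Artin's primitive root conjecture: every integer `a ≥ 2` that is not a perfect square is a
primitive root modulo infinitely many primes. -/
def ArtinPrimitiveRootConjecture : Prop :=
  ∀ a : ℕ, 2 ≤ a → ¬ IsSquare a →
    {p : ℕ | p.Prime ∧ ¬ p ∣ a ∧ orderOf (a : ZMod p) = p - 1}.Infinite

/-- `π(y; q, a)`, the number of primes `p ≤ y` with `p ≡ a (mod q)`. -/
noncomputable def primeCountingAP (y : ℝ) (q : ℕ) (a : ℤ) : ℕ :=
  {p : ℕ | p.Prime ∧ (p : ℝ) ≤ y ∧ (p : ℤ) ≡ a [ZMOD q]}.ncard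

/-- `max_{y ≤ x} max_{gcd(a, q) = 1} |π(y; q, a) - π(y) / φ(q)|`; the set is non-empty, and for
`q ≥ 1` it has only finitely many elements. -/
noncomputable def apError (x : ℝ) (q : ℕ) : ℝ :=
  sSup {r : ℝ | ∃ (y : ℝ) (a : ℤ), y ≤ x ∧ IsCoprime a (q : ℤ) ∧
    r = |(primeCountingAP y q a : ℝ) - (Nat.primeCounting ⌊y⌋₊ : ℝ) / (Nat.totient q : ℝ)|}

/-- The Elliott–Halberstam conjecture. -/
def ElliottHalberstamConjecture : Prop :=
  ∀ θ : ℝ, 0 < θ → θ < 1 → ∀ A : ℝ, 0 < A → ∃ C : ℝ, 0 < C ∧ ∀ x : ℝ, 2 < x →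
    ∑ q ∈ Finset.Icc 1 ⌊x ^ θ⌋₊, apError x q ≤ C * x / (Real.log x) ^ A

/-! Singularity. The Hadamard relations force the digits of `B` to be distinct modulo N. Iterating
the maps τ_b on a large interval multiplies Lebesgue measure by at most #B/N at each step and loses
no mass of μ, so μ is singular when #B < N (`IsSelfSimilarMeasure.mutuallySingular`). When #B ≥ N,
distinctness modulo N gives μ ≤ Lebesgue measure (`IsSelfSimilarMeasure.le_volume`). Atoms never
occur: the heaviest ones would form a finite set stable under x ↦ Nx − b for two different b.

Spectrality (`HasHadamardSums.isSpectralPair`). The identity μ̂(t) = m_B(t/N) μ̂(t/N) makes the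
exponentials orthogonal. For completeness, Q(t) = ∑_λ |μ̂(t + λ)|² is the squared norm of the
projection of e_{−t} to their closed span. It is continuous, fixed by the transfer operator, and at
least 1 on extreme cycles. If it fell below 1, its set of minimum points on a suitable interval
would be finite and stable under the maps τ_ℓ of nonzero weight, so it would meet an extreme cycle,
a contradiction.

Eigenvalues. For a prime p not dividing N, Galois conjugation shows that `B` and pL satisfy the same
orthogonality relations, so the canonical spectrum for pL is a spectrum of the same μ. It equals p
times the one for L as soon as p divides bx for all b in `B` and all points x of extreme cycles for
pL. Run backwards along such a cycle, the integers bx are multiplied by N modulo p, so one value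
prime to p forces at least ord_p(N) distinct values. But the cycle is covered by (#L)^n intervals of
radius O(p/N^n), and n ≈ log_N p leaves only O(p^σ) values, where σ = log_N #L < 1. Hence large p
with ord_p(N) ≥ p^θ for some θ in (σ, 1) are eigenvalues
(`HasHadamardSums.infinite_spectralEigenvalue`).

Large orders. It remains to find, for each θ < 1, infinitely many p with ord_p(N) ≥ p^θ. Under
Artin's conjecture this holds because N is a fixed power of a nonsquare. Under Elliott–Halberstam,
for 1/2 < α < 1 there are at least X/(32 log² X) primes p ≤ X such that p − 1 has a prime factor q >
X^α. If ord_p(N) ≤ X^α, then q does not divide it, so it is at most X^{1−α}, and p divides N^k − 1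
for some k ≤ X^{1−α}. Only O(X^{2(1−α)}) primes do that, which is too few since 2(1 − α) < 1. -/

/-! ### The character `x ↦ e^{2πix}` -/

/-- The character `x ↦ e^{2πix}`. -/
noncomputable def unitExp (x : ℝ) : ℂ := Complex.exp (2 * Real.pi * Complex.I * x)

theorem unitExp_add (x y : ℝ) : unitExp (x + y) = unitExp x * unitExp y := by
  simp only [unitExp]
  rw [← Complex.exp_add]
  push_cast
  ring_nf

@[simp] theorem unitExp_zero : unitExp 0 = 1 := by simp [unitExp]

theorem unitExp_eq_exp_ofReal_mul_I (x : ℝ) :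
    unitExp x = Complex.exp ((2 * Real.pi * x : ℝ) * Complex.I) := by
  simp only [unitExp]
  push_cast
  ring_nf

@[simp] theorem norm_unitExp (x : ℝ) : ‖unitExp x‖ = 1 := by
  rw [unitExp_eq_exp_ofReal_mul_I, Complex.norm_exp_ofReal_mul_I]

theorem unitExp_neg (x : ℝ) : unitExp (-x) = (starRingEnd ℂ) (unitExp x) := by
  simp [unitExp, ← Complex.exp_conj, Complex.conj_ofNat]

theorem unitExp_sub (x y : ℝ) : unitExp (x - y) = unitExp x * (starRingEnd ℂ) (unitExp y) := by
  rw [sub_eq_add_neg, unitExp_add, unitExp_neg]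

theorem unitExp_eq_one_iff (x : ℝ) : unitExp x = 1 ↔ ∃ n : ℤ, x = n := by
  have hpi : (2 * Real.pi * Complex.I : ℂ) ≠ 0 := Complex.two_pi_I_ne_zero
  rw [unitExp, Complex.exp_eq_one_iff]
  refine exists_congr fun n => ?_
  rw [mul_comm (n : ℂ), mul_right_inj' hpi]
  norm_cast

@[simp] theorem unitExp_intCast (n : ℤ) : unitExp n = 1 := (unitExp_eq_one_iff _).2 ⟨n, rfl⟩

theorem continuous_unitExp : Continuous unitExp := by
  unfold unitExp
  fun_prop

theorem unitExp_natCast_mul (n : ℕ) (x : ℝ) : unitExp (n * x) = unitExp x ^ n := by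
  simp only [unitExp]
  rw [← Complex.exp_nat_mul]
  push_cast
  ring_nf

/-! ### The mask `m_B` -/

theorem maskFun_eq (B : Finset ℤ) (x : ℝ) :
    maskFun B x = (B.card : ℂ)⁻¹ * ∑ b ∈ B, unitExp (b * x) := by
  simp [maskFun, unitExp]

theorem continuous_maskFun (B : Finset ℤ) : Continuous (maskFun B) := by
  unfold maskFun
  fun_prop

theorem maskFun_zero {B : Finset ℤ} (hB : B.Nonempty) : maskFun B 0 = 1 := by
  have : (B.card : ℂ) ≠ 0 := by simpa using hB.ne_empty
  simp [maskFun_eq, this]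

theorem maskFun_add_of_forall_int {B : Finset ℤ} {y : ℝ} (hy : ∀ b ∈ B, ∃ n : ℤ, (b : ℝ) * y = n)
    (x : ℝ) : maskFun B (x + y) = maskFun B x := by
  rw [maskFun_eq, maskFun_eq]
  congr 1
  refine Finset.sum_congr rfl fun b hb => ?_
  obtain ⟨n, hn⟩ := hy b hb
  rw [mul_add, unitExp_add, hn, unitExp_intCast, mul_one]

theorem norm_maskFun_of_forall_int {B : Finset ℤ} (hB : B.Nonempty) {y : ℝ}
    (hy : ∀ b ∈ B, ∃ n : ℤ, (b : ℝ) * y = n) : ‖maskFun B y‖ = 1 := by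
  rw [← zero_add y, maskFun_add_of_forall_int hy, maskFun_zero hB, norm_one]

/-- Equality case of the triangle inequality: the sum of |e^{2πibx} − u|² vanishes, so all terms
equal u, and b = 0 gives u = 1. The analytic condition on cycles thus becomes the arithmetic one Bx
⊂ ℤ. -/
theorem forall_int_of_norm_maskFun_eq_one {B : Finset ℤ} (h0 : (0 : ℤ) ∈ B) {x : ℝ}
    (hx : ‖maskFun B x‖ = 1) : ∀ b ∈ B, ∃ n : ℤ, (b : ℝ) * x = n := by
  set u := maskFun B x with hu
  have hM : (B.card : ℂ) ≠ 0 := by simpa using Finset.ne_empty_of_mem h0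
  have hsum : ∑ b ∈ B, unitExp (b * x) = B.card * u := by
    rw [hu, maskFun_eq, mul_inv_cancel_left₀ hM]
  have huu : u * (starRingEnd ℂ) u = 1 := by rw [Complex.mul_conj']; simp [hx]
  have key : ∑ b ∈ B, ‖unitExp (b * x) - u‖ ^ 2 = 0 := by
    have h1 : ∀ b ∈ B, ((‖unitExp (b * x) - u‖ ^ 2 : ℝ) : ℂ)
        = 2 - unitExp (b * x) * (starRingEnd ℂ) u
          - (starRingEnd ℂ) (unitExp (b * x) * (starRingEnd ℂ) u) := by
      intro b _
      have hz : unitExp (b * x) * (starRingEnd ℂ) (unitExp (b * x)) = 1 := by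
        rw [Complex.mul_conj']; simp
      push_cast
      rw [← Complex.mul_conj', map_sub, map_mul, Complex.conj_conj]
      linear_combination hz + huu
    have h2 : ((∑ b ∈ B, ‖unitExp (b * x) - u‖ ^ 2 : ℝ) : ℂ) = 0 := by
      rw [Complex.ofReal_sum, Finset.sum_congr rfl h1, Finset.sum_sub_distrib,
        Finset.sum_sub_distrib, ← map_sum, ← Finset.sum_mul, hsum, mul_assoc, huu]
      simp
      ring
    exact_mod_cast h2
  have heq : ∀ b ∈ B, unitExp (b * x) = u := fun b hb => by
    have := (Finset.sum_eq_zero_iff_of_nonneg fun b _ => by positivity).1 key b hb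
    exact sub_eq_zero.1 (norm_eq_zero.1 (pow_eq_zero_iff two_ne_zero |>.1 this))
  have hu1 : u = 1 := by simpa using (heq 0 h0).symm
  exact fun b hb => (unitExp_eq_one_iff _).1 ((heq b hb).trans hu1)

/-! ### Vanishing exponential sums of a Hadamard triple -/

/-- The orthogonality relations between the rows and between the columns of the matrix of a
Hadamard triple, as vanishing sums of roots of unity. -/
structure HasHadamardSums (N : ℕ) (B L : Finset ℤ) : Prop where
  two_le : 2 ≤ N
  card_eq : B.card = L.card
  two_le_card : 2 ≤ B.card
  sum_right : ∀ b ∈ B, ∀ b' ∈ B, b ≠ b' → ∑ l ∈ L, unitExp (((b - b') * l : ℤ) / N) = 0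
  sum_left : ∀ l ∈ L, ∀ l' ∈ L, l ≠ l' → ∑ b ∈ B, unitExp ((b * (l - l') : ℤ) / N) = 0

theorem hadamardMatrix_apply (N : ℕ) (B L : Finset ℤ) (b : B) (l : L) :
    hadamardMatrix N B L b l =
      ((1 / Real.sqrt (B.card : ℝ) : ℝ) : ℂ) * unitExp (((b : ℤ) * (l : ℤ) : ℤ) / N) := by
  simp [hadamardMatrix, unitExp]

theorem IsHadamardTriple.hasHadamardSums {N : ℕ} {B L : Finset ℤ} (h : IsHadamardTriple N B L) :
    HasHadamardSums N B L := by
  have hB : (0 : ℝ) < B.card := by exact_mod_cast (by have := h.two_le_card; omega : 0 < B.card)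
  have hc : ((1 / Real.sqrt (B.card : ℝ) : ℝ) : ℂ) ≠ 0 := by
    rw [Complex.ofReal_ne_zero]
    positivity
  refine ⟨h.two_le, h.card_eq, h.two_le_card, fun b hb b' hb' hne => ?_,
    fun l hl l' hl' hne => ?_⟩
  · have := congr_fun (congr_fun h.mul_conjTranspose ⟨b, hb⟩) ⟨b', hb'⟩
    rw [Matrix.one_apply_ne (by simpa using hne), Matrix.mul_apply] at this
    rw [← Finset.sum_coe_sort]
    have h2 : ∑ l : L, hadamardMatrix N B L ⟨b, hb⟩ l * (hadamardMatrix N B L).conjTranspose l ⟨b', hb'⟩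
        = ((1 / Real.sqrt (B.card : ℝ) : ℝ) : ℂ) ^ 2 *
          ∑ l : L, unitExp (((b - b') * (l : ℤ) : ℤ) / N) := by
      rw [Finset.mul_sum]
      refine Finset.sum_congr rfl fun l _ => ?_
      rw [Matrix.conjTranspose_apply, hadamardMatrix_apply, hadamardMatrix_apply, Complex.star_def,
        map_mul, Complex.conj_ofReal, sub_mul, Int.cast_sub, sub_div, unitExp_sub]
      ring
    rw [h2] at this
    exact (mul_eq_zero.1 this).resolve_left (pow_ne_zero _ hc)
  · have := congr_fun (congr_fun h.conjTranspose_mul ⟨l', hl'⟩) ⟨l, hl⟩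
    rw [Matrix.one_apply_ne (by simpa using hne.symm), Matrix.mul_apply] at this
    rw [← Finset.sum_coe_sort]
    have h2 : ∑ b : B, (hadamardMatrix N B L).conjTranspose ⟨l', hl'⟩ b * hadamardMatrix N B L b ⟨l, hl⟩
        = ((1 / Real.sqrt (B.card : ℝ) : ℝ) : ℂ) ^ 2 *
          ∑ b : B, unitExp (((b : ℤ) * (l - l') : ℤ) / N) := by
      rw [Finset.mul_sum]
      refine Finset.sum_congr rfl fun b _ => ?_
      rw [Matrix.conjTranspose_apply, hadamardMatrix_apply, hadamardMatrix_apply, Complex.star_def,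
        map_mul, Complex.conj_ofReal, mul_sub, Int.cast_sub, sub_div, unitExp_sub]
      ring
    rw [h2] at this
    exact (mul_eq_zero.1 this).resolve_left (pow_ne_zero _ hc)

/-- A vanishing sum of `N`-th roots of unity stays so when all terms are raised to a power prime
to `N`. -/
theorem sum_unitExp_mul_eq_zero {ι : Type*} {N p : ℕ} (hN : N ≠ 0) (hp : p.Coprime N)
    (s : Finset ι) (f : ι → ℤ) (h : ∑ i ∈ s, unitExp (f i / N) = 0) :
    ∑ i ∈ s, unitExp ((p * f i : ℤ) / N) = 0 := by
  have hN0 : (N : ℝ) ≠ 0 := by exact_mod_cast hN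
  set ζ := unitExp (1 / N) with hζ
  have hprim : IsPrimitiveRoot ζ N := by
    have := Complex.isPrimitiveRoot_exp N hN
    convert this using 1
    simp [hζ, unitExp]
    ring_nf
  have hpow : ∀ k : ℤ, unitExp (k / N) = ζ ^ (k % N).toNat := by
    intro k
    have h1 : (k : ℝ) / N = ((k % N).toNat : ℝ) * (1 / N) + (k / N : ℤ) := by
      have h2 : ((k % N).toNat : ℤ) = k % N := Int.toNat_of_nonneg (Int.emod_nonneg _ (by omega))
      have h3 : ((k % N).toNat : ℝ) = ((k % N : ℤ) : ℝ) := by exact_mod_cast h2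
      have h4 : (k : ℝ) = ((k % N : ℤ) : ℝ) + N * ((k / N : ℤ) : ℝ) := by
        exact_mod_cast (Int.emod_add_mul_ediv k N).symm
      rw [h3]
      field_simp
      linarith
    rw [h1, unitExp_add, unitExp_intCast, mul_one, unitExp_natCast_mul]
  -- Exponents are reduced modulo N so that the sum becomes the value at ζ of an integer polynomial.
  let P : Polynomial ℤ := ∑ i ∈ s, Polynomial.X ^ (f i % N).toNat
  have hP : Polynomial.aeval ζ P = 0 := by
    simp only [P, map_sum, map_pow, Polynomial.aeval_X]
    rw [← h]
    exact Finset.sum_congr rfl fun i _ => (hpow _).symm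
  have hint : IsIntegral ℤ ζ := hprim.isIntegral (Nat.pos_of_ne_zero hN)
  obtain ⟨R, hR⟩ := minpoly.isIntegrallyClosed_dvd hint hP
  have hPp : Polynomial.aeval (ζ ^ p) P = 0 := by
    -- As p is prime to N, ζ^p is a Galois conjugate of ζ: it has the same minimal polynomial, which
    -- divides P.
    rw [hR, map_mul, hprim.minpoly_eq_pow_coprime hp, minpoly.aeval, zero_mul]
  simp only [P, map_sum, map_pow, Polynomial.aeval_X] at hPp
  rw [← hPp]
  refine Finset.sum_congr rfl fun i _ => ?_
  rw [← pow_mul, mul_comm p, pow_mul, ← hpow, Int.cast_mul, Int.cast_natCast, mul_div_assoc,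
    unitExp_natCast_mul]

theorem HasHadamardSums.image_mul {N : ℕ} {B L : Finset ℤ} (h : HasHadamardSums N B L) {p : ℕ}
    (hp : p.Coprime N) (hp0 : p ≠ 0) : HasHadamardSums N B (L.image fun l => (p : ℤ) * l) := by
  have hN : N ≠ 0 := by have := h.two_le; omega
  have hinj : Function.Injective fun l : ℤ => (p : ℤ) * l :=
    mul_right_injective₀ (by exact_mod_cast hp0)
  refine ⟨h.two_le, ?_, h.two_le_card, fun b hb b' hb' hne => ?_, ?_⟩
  · rw [Finset.card_image_of_injective _ hinj, h.card_eq]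
  · rw [Finset.sum_image fun _ _ _ _ e => hinj e,
      ← sum_unitExp_mul_eq_zero hN hp L _ (h.sum_right b hb b' hb' hne)]
    exact Finset.sum_congr rfl fun l _ => by ring_nf
  · simp only [Finset.mem_image]
    rintro _ ⟨l, hl, rfl⟩ _ ⟨l', hl', rfl⟩ hne
    rw [← sum_unitExp_mul_eq_zero hN hp B _ (h.sum_left l hl l' hl' fun e => hne (by rw [e]))]
    exact Finset.sum_congr rfl fun b _ => by ring_nf

theorem HasHadamardSums.maskFun_sub_div {N : ℕ} {B L : Finset ℤ} (h : HasHadamardSums N B L)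
    {l l' : ℤ} (hl : l ∈ L) (hl' : l' ∈ L) (hne : l ≠ l') :
    maskFun B (((l - l' : ℤ) : ℝ) / N) = 0 := by
  rw [maskFun_eq, mul_eq_zero]
  right
  rw [← h.sum_left l hl l' hl' hne]
  refine Finset.sum_congr rfl fun b _ => ?_
  rw [Int.cast_mul, mul_div_assoc]

/-- Otherwise every term of the row relation would be 1 and the sum would be #L ≠ 0. -/
theorem HasHadamardSums.eq_of_dvd_left {N : ℕ} {B L : Finset ℤ} (h : HasHadamardSums N B L)
    {b b' : ℤ} (hb : b ∈ B) (hb' : b' ∈ B) (hd : (N : ℤ) ∣ b - b') : b = b' := by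
  by_contra hne
  have hN : (N : ℝ) ≠ 0 := by have := h.two_le; positivity
  obtain ⟨k, hk⟩ := hd
  have := h.sum_right b hb b' hb' hne
  rw [Finset.sum_congr rfl fun l _ => (by
    rw [hk, mul_assoc, Int.cast_mul, Int.cast_natCast, mul_div_cancel_left₀ _ hN,
      unitExp_intCast] : unitExp (((b - b') * l : ℤ) / N) = 1)] at this
  have hc := h.card_eq
  have hc2 := h.two_le_card
  simp only [Finset.sum_const, nsmul_eq_mul, mul_one, Nat.cast_eq_zero] at this
  omega

theorem HasHadamardSums.eq_of_dvd_right {N : ℕ} {B L : Finset ℤ} (h : HasHadamardSums N B L)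
    {l l' : ℤ} (hl : l ∈ L) (hl' : l' ∈ L) (hd : (N : ℤ) ∣ l - l') : l = l' := by
  by_contra hne
  have hN : (N : ℝ) ≠ 0 := by have := h.two_le; positivity
  obtain ⟨k, hk⟩ := hd
  have := h.sum_left l hl l' hl' hne
  rw [Finset.sum_congr rfl fun b _ => (by
    rw [hk, mul_left_comm, Int.cast_mul, Int.cast_natCast, mul_div_cancel_left₀ _ hN,
      unitExp_intCast] : unitExp ((b * (l - l') : ℤ) / N) = 1)] at this
  have hc2 := h.two_le_card
  simp only [Finset.sum_const, nsmul_eq_mul, mul_one, Nat.cast_eq_zero] at this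
  omega

/-- After expanding the squares, row orthogonality removes all terms with b ≠ b'. The weights
|m_B(τ_ℓ(t))|² are therefore transition probabilities, and the transfer operator is an averaging
operator. -/
theorem HasHadamardSums.sum_norm_maskFun_sq {N : ℕ} {B L : Finset ℤ} (h : HasHadamardSums N B L)
    (t : ℝ) : ∑ l ∈ L, ‖maskFun B (ifsMap N l t)‖ ^ 2 = 1 := by
  have hM : (B.card : ℂ) ≠ 0 := by
    have := h.two_le_card
    exact_mod_cast (by omega : B.card ≠ 0)
  have hterm : ∀ l : ℤ, ((‖maskFun B (ifsMap N l t)‖ ^ 2 : ℝ) : ℂ) = ((B.card : ℂ)⁻¹) ^ 2 *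
      ∑ b ∈ B, ∑ b' ∈ B, unitExp ((b - b') * t / N) * unitExp (((b - b') * l : ℤ) / N) := by
    intro l
    push_cast
    rw [← Complex.mul_conj', maskFun_eq, map_mul, map_sum, map_inv₀, Complex.conj_natCast]
    rw [mul_mul_mul_comm, ← sq, Finset.sum_mul_sum]
    congr 1
    refine Finset.sum_congr rfl fun b _ => Finset.sum_congr rfl fun b' _ => ?_
    rw [← unitExp_sub, ← unitExp_add, ifsMap]
    congr 1
    ring
  have hC : ((∑ l ∈ L, ‖maskFun B (ifsMap N l t)‖ ^ 2 : ℝ) : ℂ) = 1 := by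
    rw [Complex.ofReal_sum, Finset.sum_congr rfl fun l _ => hterm l, ← Finset.mul_sum,
      Finset.sum_comm]
    have : ∀ b ∈ B, ∑ l ∈ L, ∑ b' ∈ B,
        unitExp ((b - b') * t / N) * unitExp (((b - b') * l : ℤ) / N) = B.card := by
      intro b hb
      rw [Finset.sum_comm, Finset.sum_eq_single_of_mem b hb]
      · simp [h.card_eq]
      · intro b' hb' hne
        rw [← Finset.mul_sum, h.sum_right b hb b' hb' hne.symm, mul_zero]
    rw [Finset.sum_congr rfl this]
    simp only [Finset.sum_const, nsmul_eq_mul]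
    field_simp
  exact_mod_cast hC

/-! ### Continuity and singularity of the self-similar measure -/

theorem isSelfSimilarMeasure_selfSimilarMeasure {N : ℕ} (hN : 2 ≤ N) {B : Finset ℤ}
    (hB : B.Nonempty) : IsSelfSimilarMeasure N B (selfSimilarMeasure N B) :=
  (isSelfSimilarMeasure_iff hN hB _).2 rfl

theorem IsSelfSimilarMeasure.apply {N : ℕ} {B : Finset ℤ} {μ : Measure ℝ}
    (h : IsSelfSimilarMeasure N B μ) {S : Set ℝ} (hS : MeasurableSet S) :
    μ S = (B.card : ENNReal)⁻¹ * ∑ b ∈ B, μ (ifsMap N b ⁻¹' S) := by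
  conv_lhs => rw [h.2]
  rw [Measure.smul_apply, Measure.finsetSum_apply, smul_eq_mul]
  congr 1
  exact Finset.sum_congr rfl fun b _ => Measure.map_apply (measurable_ifsMap N b) hS

theorem ifsMap_preimage_singleton {N : ℕ} (hN : N ≠ 0) (c : ℤ) (x : ℝ) :
    ifsMap N c ⁻¹' {x} = {N * x - c} := by
  have hN0 : (N : ℝ) ≠ 0 := by exact_mod_cast hN
  ext y
  simp only [ifsMap, Set.mem_preimage, Set.mem_singleton_iff, div_eq_iff hN0]
  constructor <;> intro h <;> linarith

theorem IsSelfSimilarMeasure.measure_singleton {N : ℕ} (hN : 2 ≤ N) {B : Finset ℤ}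
    (hB : 2 ≤ B.card) {μ : Measure ℝ} (h : IsSelfSimilarMeasure N B μ) (x₀ : ℝ) :
    μ {x₀} = 0 := by
  have := h.1
  by_contra hx₀
  have hpos : 0 < μ.real {x₀} := by
    rw [Measure.real, ENNReal.toReal_pos_iff]
    exact ⟨pos_iff_ne_zero.2 hx₀, measure_lt_top _ _⟩
  have hMpos : (0 : ℝ) < B.card := by exact_mod_cast (by omega : 0 < B.card)
  have hreal : ∀ x, B.card * μ.real {x} = ∑ b ∈ B, μ.real {N * x - b} := by
    intro x
    rw [Measure.real, h.apply (measurableSet_singleton x), ENNReal.toReal_mul, ENNReal.toReal_inv,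
      ENNReal.toReal_natCast, mul_inv_cancel_left₀ hMpos.ne', ENNReal.toReal_sum (by simp)]
    exact Finset.sum_congr rfl fun b _ => by
      rw [ifsMap_preimage_singleton (by omega), Measure.real]
  have hfin : {x | μ.real {x₀} ≤ μ.real {x}}.Finite := by
    have := Measure.finite_const_le_meas_of_disjoint_iUnion μ (ε := μ {x₀}) (pos_iff_ne_zero.2 hx₀)
      (As := fun x : ℝ => {x}) (fun x => measurableSet_singleton x)
      (fun x y hxy => by simpa using hxy) (measure_ne_top _ _)
    refine this.subset fun x hx => ?_
    simpa [Measure.real, ENNReal.toReal_le_toReal] using hx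
  obtain ⟨x₁, hx₁, hmax⟩ := Set.exists_max_image _ (fun x => μ.real {x}) hfin
    ⟨x₀, Set.mem_ofPred.2 le_rfl⟩
  have hle : ∀ x, μ.real {x} ≤ μ.real {x₁} := by
    intro x
    rcases le_total (μ.real {x₀}) (μ.real {x}) with hx | hx
    · exact hmax x hx
    · exact hx.trans hx₁
  let A : Set ℝ := {x | μ.real {x} = μ.real {x₁}}
  have hAfin : A.Finite := hfin.subset fun x (hx : _ = _) => by
    rw [Set.mem_ofPred_eq, hx]; exact hx₁
  -- The mass at x is the mean of the masses at the points Nx − b; if the mean is maximal, so is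
  -- each of them.
  have hstep : ∀ x ∈ A, ∀ b ∈ B, (N * x - b : ℝ) ∈ A := by
    intro x hx b hb
    have h1 : ∑ b ∈ B, (μ.real {x₁} - μ.real {(N * x - b : ℝ)}) = 0 := by
      rw [Finset.sum_sub_distrib, ← hreal x, show μ.real {x} = μ.real {x₁} from hx]
      simp
    have := (Finset.sum_eq_zero_iff_of_nonneg fun b _ => sub_nonneg.2 (hle _)).1 h1 b hb
    exact (sub_eq_zero.1 this).symm
  obtain ⟨x, hx, hxmax⟩ := Set.exists_max_image A id hAfin ⟨x₁, rfl⟩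
  obtain ⟨y, hy, hymin⟩ := Set.exists_min_image A id hAfin ⟨x₁, rfl⟩
  -- With b < b', stability gives (N − 1) max A ≤ b < b' ≤ (N − 1) min A, which is absurd.
  obtain ⟨b, hb, b', hb', hlt⟩ : ∃ b ∈ B, ∃ b' ∈ B, b < b' := by
    obtain ⟨b, hb, b', hb', hne⟩ := Finset.one_lt_card.1 (by omega : 1 < B.card)
    rcases lt_or_gt_of_ne hne with h | h
    · exact ⟨b, hb, b', hb', h⟩
    · exact ⟨b', hb', b, hb, h⟩
  have h1 := hxmax _ (hstep x hx b hb)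
  have h2 := hymin _ (hstep y hy b' hb')
  have h3 := hymin x hx
  simp only [id] at h1 h2 h3
  have h4 : (b : ℝ) < b' := by exact_mod_cast hlt
  have h5 : (2 : ℝ) ≤ N := by exact_mod_cast hN
  nlinarith

/-- The union of the images `τ_b(S)`, `b ∈ B`. -/
def ifsUnion (N : ℕ) (B : Finset ℤ) (S : Set ℝ) : Set ℝ :=
  ⋃ b ∈ B, (fun y : ℝ => N * y - b) ⁻¹' S

theorem measurableSet_ifsUnion (N : ℕ) (B : Finset ℤ) {S : Set ℝ} (hS : MeasurableSet S) :
    MeasurableSet (ifsUnion N B S) :=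
  Finset.measurableSet_biUnion _ fun b _ => (by fun_prop : Measurable fun y : ℝ => N * y - b) hS

theorem volume_ifsUnion_le {N : ℕ} (hN : N ≠ 0) (B : Finset ℤ) (S : Set ℝ) :
    volume (ifsUnion N B S) ≤ (B.card / N : NNReal) * volume S := by
  have hN0 : (N : ℝ) ≠ 0 := by exact_mod_cast hN
  refine (measure_biUnion_finset_le _ _).trans ?_
  have : ∀ b ∈ B, volume ((fun y : ℝ => N * y - b) ⁻¹' S) = ((N : NNReal)⁻¹ : NNReal) * volume S := by
    intro b _
    have h1 : (fun y : ℝ => N * y - b) ⁻¹' S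
        = (fun y : ℝ => (N : ℝ) * y) ⁻¹' ((fun y : ℝ => y + -b) ⁻¹' S) := rfl
    rw [h1, Real.volume_preimage_mul_left hN0, measure_preimage_add_right]
    congr 1
    rw [abs_of_nonneg (by positivity), ENNReal.ofReal]
    congr 1
    ext
    simp
  rw [Finset.sum_congr rfl this, Finset.sum_const, nsmul_eq_mul, ← mul_assoc, div_eq_mul_inv]
  push_cast
  rfl

theorem IsSelfSimilarMeasure.le_apply_ifsUnion {N : ℕ} (hN : N ≠ 0) {B : Finset ℤ}
    (hB : B.Nonempty) {μ : Measure ℝ} (h : IsSelfSimilarMeasure N B μ) {S : Set ℝ}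
    (hS : MeasurableSet S) : μ S ≤ μ (ifsUnion N B S) := by
  have hN0 : (N : ℝ) ≠ 0 := by exact_mod_cast hN
  rw [h.apply (measurableSet_ifsUnion N B hS)]
  have h1 : ∑ b ∈ B, μ S ≤ ∑ b ∈ B, μ (ifsMap N b ⁻¹' ifsUnion N B S) := by
    refine Finset.sum_le_sum fun b hb => measure_mono fun x hx => ?_
    simp only [ifsUnion, Set.mem_preimage, Set.mem_iUnion]
    refine ⟨b, hb, ?_⟩
    rw [ifsMap, mul_div_cancel₀ _ hN0, add_sub_cancel_right]
    exact hx
  have hB0 : (B.card : ENNReal) ≠ 0 := by simpa using hB.ne_empty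
  calc μ S = (B.card : ENNReal)⁻¹ * ∑ b ∈ B, μ S := by
        rw [Finset.sum_const, nsmul_eq_mul, ← mul_assoc, ENNReal.inv_mul_cancel hB0 (by simp),
          one_mul]
    _ ≤ _ := by gcongr

theorem ifsUnion_mono (N : ℕ) (B : Finset ℤ) : Monotone (ifsUnion N B) := fun _ _ h =>
  Set.iUnion₂_mono fun _ _ => Set.preimage_mono h

theorem ifsUnion_Icc_subset {N : ℕ} (hN : 2 ≤ N) {B : Finset ℤ} {R : ℝ}
    (hR : ∀ b ∈ B, |(b : ℝ)| ≤ R) : ifsUnion N B (Set.Icc (-R) R) ⊆ Set.Icc (-R) R := by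
  intro y hy
  simp only [ifsUnion, Set.mem_preimage, Set.mem_iUnion, Set.mem_Icc] at hy
  obtain ⟨b, hb, h1, h2⟩ := hy
  have h3 := abs_le.1 (hR b hb)
  have h5 : (2 : ℝ) ≤ N := by exact_mod_cast hN
  have hR0 : 0 ≤ R := (abs_nonneg _).trans (hR b hb)
  constructor <;> by_contra hc <;> push Not at hc <;> nlinarith

theorem IsSelfSimilarMeasure.mutuallySingular {N : ℕ} (hN : 2 ≤ N) {B : Finset ℤ}
    (hB : B.Nonempty) (hcard : B.card < N) {μ : Measure ℝ} (h : IsSelfSimilarMeasure N B μ) :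
    μ ⟂ₘ (volume : Measure ℝ) := by
  have := h.1
  obtain ⟨R₀, hR₀⟩ : ∃ R₀ : ℕ, ∀ b ∈ B, |(b : ℝ)| ≤ R₀ := by
    refine ⟨∑ b ∈ B, b.natAbs, fun b hb => ?_⟩
    have h1 : (b.natAbs : ℝ) = |(b : ℝ)| := by rw [Nat.cast_natAbs, Int.cast_abs]
    rw [← h1]
    exact_mod_cast Finset.single_le_sum (f := fun b : ℤ => b.natAbs) (fun _ _ => Nat.zero_le _) hb
  -- Once the radius exceeds all digits, each interval is stable under the τ_b. Since the intervals
  -- exhaust the line, the limit sets carry all the mass and the support of μ need not be located.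
  let S : ℕ → Set ℝ := fun R => Set.Icc (-((R + R₀ : ℕ) : ℝ)) ((R + R₀ : ℕ) : ℝ)
  have hSm : ∀ R n, MeasurableSet ((ifsUnion N B)^[n] (S R)) := by
    intro R n
    induction n with
    | zero => exact measurableSet_Icc
    | succ n ih => rw [Function.iterate_succ_apply']; exact measurableSet_ifsUnion N B ih
  have hSsub : ∀ R, ifsUnion N B (S R) ⊆ S R := fun R =>
    ifsUnion_Icc_subset hN fun b hb => (hR₀ b hb).trans (by exact_mod_cast Nat.le_add_left _ _)
  have hanti : ∀ R, Antitone fun n => (ifsUnion N B)^[n] (S R) := fun R =>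
    (ifsUnion_mono N B).antitone_iterate_of_map_le (hSsub R)
  have hvol : ∀ R, volume (⋂ n, (ifsUnion N B)^[n] (S R)) = 0 := by
    intro R
    have hle : ∀ n, volume ((ifsUnion N B)^[n] (S R))
        ≤ ((B.card / N : NNReal) : ENNReal) ^ n * volume (S R) := by
      intro n
      induction n with
      | zero => simp
      | succ n ih =>
        rw [Function.iterate_succ_apply', pow_succ', mul_assoc]
        exact (volume_ifsUnion_le (by omega) B _).trans (by gcongr)
    have hlt : ((B.card / N : NNReal) : ENNReal) < 1 := by
      rw [ENNReal.coe_lt_one_iff, div_lt_one (by positivity)]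
      exact_mod_cast hcard
    have hlim := ENNReal.Tendsto.mul_const (b := volume (S R))
      (ENNReal.tendsto_pow_atTop_nhds_zero_of_lt_one hlt) (Or.inr (by simp [S]))
    rw [zero_mul] at hlim
    refine le_antisymm (ge_of_tendsto' hlim fun n => ?_) zero_le
    exact (measure_mono (Set.iInter_subset _ n)).trans (hle n)
  have hμ : ∀ R, μ (S R) ≤ μ (⋂ n, (ifsUnion N B)^[n] (S R)) := by
    intro R
    have hle : ∀ n, μ (S R) ≤ μ ((ifsUnion N B)^[n] (S R)) := by
      intro n
      induction n with
      | zero => simp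
      | succ n ih =>
        rw [Function.iterate_succ_apply']
        exact ih.trans (h.le_apply_ifsUnion (by omega) hB (hSm R n))
    have := tendsto_measure_iInter_atTop (μ := μ) (fun n => (hSm R n).nullMeasurableSet) (hanti R)
      ⟨0, measure_ne_top _ _⟩
    exact ge_of_tendsto' this hle
  have hmono : Monotone S := fun R R' hR => by
    have : ((R + R₀ : ℕ) : ℝ) ≤ ((R' + R₀ : ℕ) : ℝ) := by exact_mod_cast Nat.add_le_add_right hR _
    exact Set.Icc_subset_Icc (neg_le_neg this) this
  have hSU : ⋃ R, S R = Set.univ := by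
    refine Set.eq_univ_of_forall fun x => Set.mem_iUnion.2 ?_
    obtain ⟨n, hn⟩ := exists_nat_ge |x|
    refine ⟨n, abs_le.1 (hn.trans ?_)⟩
    exact_mod_cast Nat.le_add_right _ _
  have h1 : μ (⋃ R, ⋂ n, (ifsUnion N B)^[n] (S R)) = 1 := by
    refine le_antisymm prob_le_one ?_
    have hlim := tendsto_measure_iUnion_atTop (μ := μ) hmono
    rw [hSU, measure_univ] at hlim
    exact le_of_tendsto' hlim fun R =>
      (hμ R).trans (measure_mono (Set.subset_iUnion (fun R => ⋂ n, (ifsUnion N B)^[n] (S R)) R))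
  have hm : MeasurableSet (⋃ R, ⋂ n, (ifsUnion N B)^[n] (S R)) :=
    MeasurableSet.iUnion fun R => MeasurableSet.iInter fun n => hSm R n
  refine Measure.MutuallySingular.symm ⟨_, hm, measure_iUnion_null hvol, ?_⟩
  rwa [prob_compl_eq_zero_iff hm]

/-! ### Domination by Lebesgue measure when #B ≥ N -/

theorem ifsMap_preimage_Ioc {N : ℕ} (hN : N ≠ 0) (c : ℤ) (x y : ℝ) :
    ifsMap N c ⁻¹' Set.Ioc x y = Set.Ioc (N * x - c) (N * y - c) := by
  have hN0 : (0 : ℝ) < N := by exact_mod_cast Nat.pos_of_ne_zero hN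
  ext z
  simp only [ifsMap, Set.mem_preimage, Set.mem_Ioc, lt_div_iff₀ hN0, div_le_iff₀ hN0]
  constructor <;> rintro ⟨h1, h2⟩ <;> constructor <;> linarith

/-- If the digits are distinct modulo `N`, the periodisation of `μ` gives mass at most `(#B)⁻ⁿ` to
intervals of length `N⁻ⁿ`. -/
theorem IsSelfSimilarMeasure.tsum_Ioc_le {N : ℕ} (hN : N ≠ 0) {B : Finset ℤ}
    (hinj : ∀ b ∈ B, ∀ b' ∈ B, (N : ℤ) ∣ b - b' → b = b') {μ : Measure ℝ}
    (h : IsSelfSimilarMeasure N B μ) (n : ℕ) (a : ℝ) :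
    ∑' k : ℤ, μ (Set.Ioc (a + k) (a + k + ((N : ℝ) ^ n)⁻¹)) ≤ ((B.card : ENNReal)⁻¹) ^ n := by
  have := h.1
  have hN0 : (N : ℝ) ≠ 0 := by exact_mod_cast hN
  induction n generalizing a with
  | zero =>
    simp only [pow_zero, inv_one]
    rw [← measure_iUnion (Set.pairwise_disjoint_Ioc_add_intCast a) fun _ => measurableSet_Ioc]
    exact prob_le_one
  | succ n ih =>
    let g : ℤ → ENNReal := fun j => μ (Set.Ioc (N * a + j) (N * a + j + ((N : ℝ) ^ n)⁻¹))
    have hstep : ∀ k : ℤ, μ (Set.Ioc (a + k) (a + k + ((N : ℝ) ^ (n + 1))⁻¹))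
        = (B.card : ENNReal)⁻¹ * ∑' b : B, g (N * k - b) := by
      intro k
      rw [h.apply measurableSet_Ioc, tsum_fintype, Finset.sum_coe_sort B fun b => g (N * k - b)]
      congr 1
      refine Finset.sum_congr rfl fun b _ => ?_
      rw [ifsMap_preimage_Ioc hN]
      simp only [g]
      push_cast
      congr 2
      · ring
      · rw [pow_succ]
        field_simp
        ring
    rw [tsum_congr hstep, ENNReal.tsum_mul_left, pow_succ']
    gcongr
    refine le_trans ?_ (ih (N * a))
    -- Digits distinct modulo N make (k, b) ↦ Nk − b injective, so the double sum is part of the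
    -- periodised sum one level up.
    rw [← ENNReal.tsum_prod' (f := fun z : ℤ × B => g (N * z.1 - z.2))]
    refine ENNReal.tsum_comp_le_tsum_of_injective (f := fun z : ℤ × B => N * z.1 - (z.2 : ℤ)) ?_ g
    rintro ⟨k, b, hb⟩ ⟨k', b', hb'⟩ he
    simp only at he
    have hbb : b = b' := hinj b hb b' hb' ⟨k - k', by linear_combination -he⟩
    subst hbb
    have : (N : ℤ) * k = N * k' := by linarith
    rw [mul_right_injective₀ (by exact_mod_cast hN : (N : ℤ) ≠ 0) this]

theorem IsSelfSimilarMeasure.le_volume {N : ℕ} (hN : 2 ≤ N) {B : Finset ℤ}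
    (hinj : ∀ b ∈ B, ∀ b' ∈ B, (N : ℤ) ∣ b - b' → b = b') (hcard : N ≤ B.card) {μ : Measure ℝ}
    (h : IsSelfSimilarMeasure N B μ) : μ ≤ volume := by
  have := h.1
  have hN0 : (0 : ℝ) < N := by positivity
  have hsmall : ∀ (n : ℕ) (a : ℝ),
      μ (Set.Ioc a (a + ((N : ℝ) ^ n)⁻¹)) ≤ ENNReal.ofReal (((N : ℝ) ^ n)⁻¹) := by
    intro n a
    have h1 := (ENNReal.le_tsum (f := fun k : ℤ =>
      μ (Set.Ioc (a + k) (a + k + ((N : ℝ) ^ n)⁻¹))) 0).trans (h.tsum_Ioc_le (by omega) hinj n a)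
    simp only [Int.cast_zero, add_zero] at h1
    refine h1.trans ?_
    rw [ENNReal.ofReal_inv_of_pos (by positivity), ENNReal.ofReal_pow hN0.le, ENNReal.ofReal_natCast,
      ENNReal.inv_pow]
    gcongr
  have hmul : ∀ (n m : ℕ) (a : ℝ),
      μ (Set.Ioc a (a + m * ((N : ℝ) ^ n)⁻¹)) ≤ ENNReal.ofReal (m * ((N : ℝ) ^ n)⁻¹) := by
    intro n m a
    induction m with
    | zero => simp
    | succ m ih =>
      have hpos : (0 : ℝ) ≤ ((N : ℝ) ^ n)⁻¹ := by positivity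
      have hsplit : Set.Ioc a (a + (m + 1 : ℕ) * ((N : ℝ) ^ n)⁻¹)
          ⊆ Set.Ioc a (a + m * ((N : ℝ) ^ n)⁻¹) ∪ Set.Ioc (a + m * ((N : ℝ) ^ n)⁻¹)
            (a + m * ((N : ℝ) ^ n)⁻¹ + ((N : ℝ) ^ n)⁻¹) := by
        rintro x ⟨h1, h2⟩
        push_cast at h2
        rcases le_or_gt x (a + m * ((N : ℝ) ^ n)⁻¹) with h3 | h3
        · exact Or.inl ⟨h1, h3⟩
        · exact Or.inr ⟨h3, by linarith⟩
      refine (measure_mono hsplit).trans ((measure_union_le _ _).trans ?_)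
      refine (add_le_add ih (hsmall n _)).trans ?_
      rw [← ENNReal.ofReal_add (by positivity) hpos]
      apply ENNReal.ofReal_le_ofReal
      push_cast
      linarith
  have hIoc : ∀ a b : ℝ, μ (Set.Ioc a b) ≤ ENNReal.ofReal (b - a) := by
    intro a b
    rcases le_total b a with hab | hab
    · simp [Set.Ioc_eq_empty (not_lt.2 hab)]
    -- Rounding b − a up to a multiple of N⁻ⁿ costs at most N⁻ⁿ, which vanishes in the limit.
    have hbd : ∀ n : ℕ, μ (Set.Ioc a b) ≤ ENNReal.ofReal (b - a + ((N : ℝ) ^ n)⁻¹) := by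
      intro n
      have hδ : (0 : ℝ) < ((N : ℝ) ^ n)⁻¹ := by positivity
      have h1 := Nat.le_ceil ((b - a) / ((N : ℝ) ^ n)⁻¹)
      have h2 := Nat.ceil_lt_add_one (a := (b - a) / ((N : ℝ) ^ n)⁻¹)
        (div_nonneg (sub_nonneg.2 hab) hδ.le)
      rw [div_le_iff₀ hδ] at h1
      have h3 : (⌈(b - a) / ((N : ℝ) ^ n)⁻¹⌉₊ : ℝ) * ((N : ℝ) ^ n)⁻¹
          ≤ b - a + ((N : ℝ) ^ n)⁻¹ := by
        calc _ ≤ ((b - a) / ((N : ℝ) ^ n)⁻¹ + 1) * ((N : ℝ) ^ n)⁻¹ := by gcongr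
          _ = _ := by field_simp
      refine (measure_mono (Set.Ioc_subset_Ioc_right (by linarith))).trans ((hmul n _ a).trans
        (ENNReal.ofReal_le_ofReal h3))
    have hlim : Filter.Tendsto (fun n : ℕ => ENNReal.ofReal (b - a + ((N : ℝ) ^ n)⁻¹)) Filter.atTop
        (nhds (ENNReal.ofReal (b - a + 0))) := by
      refine ENNReal.tendsto_ofReal (tendsto_const_nhds.add ?_)
      exact (tendsto_pow_atTop_atTop_of_one_lt (by exact_mod_cast hN)).inv_tendsto_atTop
    rw [add_zero] at hlim
    exact ge_of_tendsto' hlim hbd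
  refine Measure.le_iff.2 fun s hs => ?_
  rw [Real.volume_eq_stieltjes_id, StieltjesFunction.measure_def]
  -- Lebesgue outer measure is the largest outer measure bounded by length on half-open intervals.
  have hout : μ.toOuterMeasure ≤ StieltjesFunction.id.outer := by
    refine OuterMeasure.le_ofFunction.2 fun t => ?_
    rw [StieltjesFunction.length_eq]
    refine le_iInf fun a => le_iInf fun b => le_iInf fun ht => ?_
    have hbot : (botSet : Set ℝ) = ∅ :=
      Set.eq_empty_of_forall_notMem fun x => notMem_botSet_of_lt (sub_one_lt x)
    rw [hbot, Set.sdiff_empty] at ht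
    exact (measure_mono ht).trans (hIoc a b)
  exact hout s

theorem IsSelfSimilarMeasure.not_mutuallySingular {N : ℕ} (hN : 2 ≤ N) {B : Finset ℤ}
    (hinj : ∀ b ∈ B, ∀ b' ∈ B, (N : ℤ) ∣ b - b' → b = b') (hcard : N ≤ B.card) {μ : Measure ℝ}
    (h : IsSelfSimilarMeasure N B μ) : ¬ μ ⟂ₘ (volume : Measure ℝ) := by
  have := h.1
  intro hs
  have h0 : μ = 0 := (Measure.MutuallySingular.self_iff μ).1
    (hs.mono_ac Measure.AbsolutelyContinuous.rfl
      (Measure.absolutelyContinuous_of_le (h.le_volume hN hinj hcard)))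
  exact IsProbabilityMeasure.ne_zero μ h0

theorem isSingularContinuous_selfSimilarMeasure_iff {N : ℕ} {B L : Finset ℤ}
    (h : HasHadamardSums N B L) :
    IsSingularContinuous (selfSimilarMeasure N B) ↔ B.card < N := by
  have hB : B.Nonempty := Finset.card_pos.1 (by have := h.two_le_card; omega)
  have hμ := isSelfSimilarMeasure_selfSimilarMeasure h.two_le hB
  refine ⟨fun hs => ?_, fun hlt => ⟨hμ.measure_singleton h.two_le h.two_le_card,
    hμ.mutuallySingular h.two_le hB hlt⟩⟩
  by_contra hge
  exact hμ.not_mutuallySingular h.two_le (fun b hb b' hb' => h.eq_of_dvd_left hb hb')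
    (not_lt.1 hge) hs.2

/-! ### Extreme cycles and the transfer operator -/

/-- A map of a finite set into itself that moves every point by some `τ_ℓ` to a point where
`|m_B| = 1` produces an extreme cycle. -/
theorem exists_isExtremeCycle_of_mapsTo {N : ℕ} {B L : Finset ℤ} {U : Set ℝ} (hU : U.Finite)
    (hne : U.Nonempty) (h : ∀ y ∈ U, ∃ l ∈ L, ifsMap N l y ∈ U ∧ ‖maskFun B (ifsMap N l y)‖ = 1) :
    ∃ C, IsExtremeCycle N B L C ∧ ∃ x ∈ C, x ∈ U := by
  choose! d hdL hdU hd1 using h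
  let g : ℝ → ℝ := fun y => ifsMap N (d y) y
  obtain ⟨y, hy⟩ := hne
  have hgU : ∀ n, g^[n] y ∈ U := by
    intro n
    induction n with
    | zero => exact hy
    | succ n ih => rw [Function.iterate_succ_apply']; exact hdU _ ih
  obtain ⟨i, j, hij, heq⟩ : ∃ i j, i < j ∧ g^[i] y = g^[j] y := by
    have hni : ¬ Function.Injective fun n : ℕ => (⟨g^[n] y, hgU n⟩ : U) := by
      have := hU.to_subtype
      exact not_injective_infinite_finite _
    simp only [Function.Injective, not_forall] at hni
    obtain ⟨i, j, h1, h2⟩ := hni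
    have h1 : g^[i] y = g^[j] y := by simpa using h1
    rcases lt_or_gt_of_ne h2 with h3 | h3
    · exact ⟨i, j, h3, h1⟩
    · exact ⟨j, i, h3, h1.symm⟩
  obtain ⟨k, rfl⟩ := Nat.exists_eq_add_of_lt hij
  have hone : ∀ n, ‖maskFun B (g^[n + 1] y)‖ = 1 := fun n => by
    rw [Function.iterate_succ_apply']
    exact hd1 _ (hgU n)
  let x : Fin (k + 1) → ℝ := fun m => g^[i + m] y
  refine ⟨Set.range x, ⟨k, x, fun m => d (x m), rfl, fun m => hdL _ (hgU _), fun m => ?_,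
    fun m => ?_⟩, x 0, ⟨0, rfl⟩, hgU _⟩
  · have h1 : ifsMap N (d (x m)) (x m) = g^[i + m + 1] y := by
      rw [Function.iterate_succ_apply']
    rw [h1]
    rcases eq_or_ne m (Fin.last k) with rfl | hm
    · simp only [x, Fin.last_add_one, Fin.val_zero, Fin.val_last, add_zero]
      exact heq.symm
    · have : ((m + 1 : Fin (k + 1)) : ℕ) = m + 1 := Fin.val_add_one_of_lt (Fin.lt_last_iff_ne_last.2 hm)
      simp only [x, this, add_assoc]
  -- |m_B| = 1 is known only at positive iterates; the starting point is reached again one period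
  -- later.
  · rcases Nat.eq_zero_or_pos (i + m) with h0 | h0
    · have h2 : g^[i + m] y = g^[i + k + 1] y := by
        rw [← heq, h0]
        congr 1
        omega
      simp only [x, h2]
      exact hone _
    · obtain ⟨n, hn⟩ := Nat.exists_eq_succ_of_ne_zero h0.ne'
      simp only [x, hn]
      exact hone _

open Classical in
/-- The points `τ_ℓ(y)`, `y ∈ P`, `ℓ ∈ L`, with `m_B(τ_ℓ(y)) ≠ 0`. -/
noncomputable def maskChildren (N : ℕ) (B L : Finset ℤ) (P : Finset ℝ) : Finset ℝ :=
  P.biUnion fun y => (L.filter fun l => maskFun B (ifsMap N l y) ≠ 0).image fun l => ifsMap N l y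

theorem mem_maskChildren {N : ℕ} {B L : Finset ℤ} {P : Finset ℝ} {x : ℝ} :
    x ∈ maskChildren N B L P ↔
      ∃ y ∈ P, ∃ l ∈ L, maskFun B (ifsMap N l y) ≠ 0 ∧ ifsMap N l y = x := by
  simp [maskChildren, and_assoc]

/-- Multiplying by N, the difference y − y' is an integer, so y = y'; then N divides ℓ − ℓ'. Points
pairwise incongruent modulo 1 thus have distinct, again incongruent children, which makes the count
of children exact. -/
theorem HasHadamardSums.eq_of_ifsMap_sub_eq_int {N : ℕ} {B L : Finset ℤ}
    (h : HasHadamardSums N B L) {P : Finset ℝ}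
    (hP : ∀ y ∈ P, ∀ y' ∈ P, ∀ j : ℤ, y - y' = j → y = y') {y y' : ℝ} (hy : y ∈ P) (hy' : y' ∈ P)
    {l l' : ℤ} (hl : l ∈ L) (hl' : l' ∈ L) {j : ℤ} (hj : ifsMap N l y - ifsMap N l' y' = j) :
    y = y' ∧ l = l' := by
  have hN : (N : ℝ) ≠ 0 := by have := h.two_le; positivity
  simp only [ifsMap] at hj
  field_simp at hj
  have hyy : y = y' := hP y hy y' hy' (N * j + l' - l) (by push_cast; linarith)
  subst hyy
  refine ⟨rfl, h.eq_of_dvd_right hl hl' ⟨j, ?_⟩⟩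
  have : (l : ℝ) - l' = N * j := by linarith
  exact_mod_cast this

open Classical in
theorem HasHadamardSums.card_maskChildren {N : ℕ} {B L : Finset ℤ}
    (h : HasHadamardSums N B L) {P : Finset ℝ}
    (hP : ∀ y ∈ P, ∀ y' ∈ P, ∀ j : ℤ, y - y' = j → y = y') :
    (maskChildren N B L P).card =
      ∑ y ∈ P, (L.filter fun l => maskFun B (ifsMap N l y) ≠ 0).card := by
  rw [maskChildren, Finset.card_biUnion]
  · refine Finset.sum_congr rfl fun y hy => Finset.card_image_of_injOn fun l hl l' hl' he => ?_
    simp only [Finset.coe_filter, Set.mem_ofPred_eq] at hl hl'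
    exact (h.eq_of_ifsMap_sub_eq_int hP hy hy hl.1 hl'.1 (j := 0) (by simpa [sub_eq_zero] using he)).2
  · intro y hy y' hy' hne
    rw [Function.onFun, Finset.disjoint_left]
    simp only [Finset.mem_image, Finset.mem_filter, not_exists, not_and]
    rintro _ ⟨l, hl, rfl⟩ l' hl' he
    exact hne (h.eq_of_ifsMap_sub_eq_int hP hy hy' hl.1 hl'.1 (j := 0)
      (by simpa [sub_eq_zero] using he.symm)).1

open Classical in
theorem HasHadamardSums.one_le_card_filter {N : ℕ} {B L : Finset ℤ}
    (h : HasHadamardSums N B L) (y : ℝ) :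
    1 ≤ (L.filter fun l => maskFun B (ifsMap N l y) ≠ 0).card := by
  rw [Nat.one_le_iff_ne_zero, Finset.card_ne_zero]
  by_contra hc
  rw [Finset.not_nonempty_iff_eq_empty, Finset.filter_eq_empty_iff] at hc
  have := h.sum_norm_maskFun_sq y
  rw [Finset.sum_eq_zero fun l hl => by have := hc hl; simp_all] at this
  exact zero_ne_one this

/-- A finite set that is stable under the maps `τ_ℓ` with `m_B(τ_ℓ(z)) ≠ 0` meets an extreme
cycle. -/
theorem HasHadamardSums.exists_isExtremeCycle_of_finite {N : ℕ} {B L : Finset ℤ}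
    (h : HasHadamardSums N B L) {F : Set ℝ} (hF : F.Finite) (hne : F.Nonempty)
    (hstep : ∀ z ∈ F, ∀ l ∈ L, maskFun B (ifsMap N l z) ≠ 0 → ifsMap N l z ∈ F) :
    ∃ C, IsExtremeCycle N B L C ∧ ∃ x ∈ C, x ∈ F := by
  classical
  obtain ⟨z, hz⟩ := hne
  let P : ℕ → Finset ℝ := fun n => (maskChildren N B L)^[n] {z}
  have hPs : ∀ n, P (n + 1) = maskChildren N B L (P n) := fun n => Function.iterate_succ_apply' _ _ _
  have hPF : ∀ n, ∀ y ∈ P n, y ∈ F := by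
    intro n
    induction n with
    | zero => simpa [P] using hz
    | succ n ih =>
      intro y hy
      rw [hPs, mem_maskChildren] at hy
      obtain ⟨y', hy', l, hl, hm, rfl⟩ := hy
      exact hstep y' (ih y' hy') l hl hm
  have hPI : ∀ n, ∀ y ∈ P n, ∀ y' ∈ P n, ∀ j : ℤ, y - y' = j → y = y' := by
    intro n
    induction n with
    | zero => simp [P]
    | succ n ih =>
      intro y hy y' hy' j hj
      rw [hPs, mem_maskChildren] at hy hy'
      obtain ⟨w, hw, l, hl, -, rfl⟩ := hy
      obtain ⟨w', hw', l', hl', -, rfl⟩ := hy'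
      obtain ⟨rfl, rfl⟩ := h.eq_of_ifsMap_sub_eq_int ih hw hw' hl hl' hj
      rfl
  have hmono : Monotone fun n => (P n).card := by
    refine monotone_nat_of_le_succ fun n => ?_
    rw [hPs, h.card_maskChildren (hPI n), Finset.card_eq_sum_ones]
    exact Finset.sum_le_sum fun y _ => h.one_le_card_filter y
  have hbdd : ∀ n, (P n).card ≤ hF.toFinset.card := fun n =>
    Finset.card_le_card fun y hy => hF.mem_toFinset.2 (hPF n y hy)
  obtain ⟨n₀, hn₀⟩ : ∃ n₀, ∀ n ≥ n₀, (P n).card = (P n₀).card := by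
    have hfin : (Set.range fun n => (P n).card).Finite :=
      (Set.finite_Iic hF.toFinset.card).subset (by rintro _ ⟨n, rfl⟩; exact hbdd n)
    obtain ⟨_, ⟨n₀, rfl⟩, hmax⟩ := Set.exists_max_image _ id hfin ⟨_, 0, rfl⟩
    exact ⟨n₀, fun n hn => le_antisymm (hmax _ ⟨n, rfl⟩) (hmono hn)⟩
  -- The number of points never decreases and is bounded by #F. Once it is constant, each point has
  -- exactly one child, which carries the whole weight 1.
  have huniq : ∀ n ≥ n₀, ∀ y ∈ P n, ∃ l ∈ L, ifsMap N l y ∈ P (n + 1) ∧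
      ‖maskFun B (ifsMap N l y)‖ = 1 := by
    intro n hn y hy
    have h1 : ∑ y ∈ P n, (L.filter fun l => maskFun B (ifsMap N l y) ≠ 0).card
        = ∑ y ∈ P n, 1 := by
      rw [← h.card_maskChildren (hPI n), ← hPs, ← Finset.card_eq_sum_ones, hn₀ n hn,
        hn₀ (n + 1) (by omega)]
    have h2 := (Finset.sum_eq_sum_iff_of_le fun y _ => h.one_le_card_filter y).1 h1.symm y hy
    obtain ⟨l, hl⟩ := Finset.card_eq_one.1 h2.symm
    have hlm : l ∈ L.filter fun l => maskFun B (ifsMap N l y) ≠ 0 := by simp [hl]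
    rw [Finset.mem_filter] at hlm
    refine ⟨l, hlm.1, ?_, ?_⟩
    · rw [hPs, mem_maskChildren]
      exact ⟨y, hy, l, hlm.1, hlm.2, rfl⟩
    · have h3 := h.sum_norm_maskFun_sq y
      rw [Finset.sum_eq_single_of_mem l hlm.1] at h3
      · exact (pow_eq_one_iff_of_nonneg (norm_nonneg _) two_ne_zero).1 h3
      · intro l' hl' hne
        by_contra hc
        have : l' ∈ L.filter fun l => maskFun B (ifsMap N l y) ≠ 0 := by
          rw [Finset.mem_filter]
          exact ⟨hl', fun h0 => hc (by simp [h0])⟩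
        rw [hl, Finset.mem_singleton] at this
        exact hne this
  let U : Set ℝ := {y | ∃ n ≥ n₀, y ∈ P n}
  have hUF : U ⊆ F := fun y ⟨n, _, hy⟩ => hPF n y hy
  have hUne : U.Nonempty := by
    have h0 : 0 < (P n₀).card := by
      have := hmono (Nat.zero_le n₀)
      simp only [P, Function.iterate_zero, id, Finset.card_singleton] at this
      exact this
    obtain ⟨y, hy⟩ := Finset.card_pos.1 h0
    exact ⟨y, n₀, le_refl _, hy⟩
  obtain ⟨C, hC, x, hxC, hxU⟩ := exists_isExtremeCycle_of_mapsTo (N := N) (B := B) (L := L)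
    (hF.subset hUF) hUne (by
      rintro y ⟨n, hn, hy⟩
      obtain ⟨l, hl, h1, h2⟩ := huniq n hn y hy
      exact ⟨l, hl, ⟨n + 1, by omega, h1⟩, h2⟩)
  exact ⟨C, hC, x, hxC, hUF hxU⟩

/-- m_B is real-analytic and m_B(0) = 1, so its zeros cannot accumulate. -/
theorem finite_maskFun_zeros {B : Finset ℤ} (hB : B.Nonempty) (K : ℝ) :
    {x | x ∈ Set.Icc (-K) K ∧ maskFun B x = 0}.Finite := by
  by_contra hinf
  obtain ⟨x, -, hx⟩ := Set.Infinite.exists_accPt_of_subset_isCompact hinf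
    (isCompact_Icc (a := -K) (b := K)) fun y hy => hy.1
  have han : AnalyticOnNhd ℝ (maskFun B) Set.univ := by
    intro y _
    unfold maskFun
    have hd : ∀ b : ℤ, AnalyticAt ℝ
        (fun x : ℝ => Complex.exp (2 * Real.pi * Complex.I * (b * x))) y := by
      intro b
      have h1 : AnalyticAt ℝ (fun x : ℝ => (x : ℂ)) y := Complex.ofRealCLM.analyticAt y
      have h2 : AnalyticAt ℝ (fun x : ℝ => (2 * Real.pi * Complex.I * (b * x) : ℂ)) y :=
        analyticAt_const.mul (analyticAt_const.mul h1)
      exact (analyticAt_cexp.restrictScalars).comp h2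
    exact analyticAt_const.mul (Finset.analyticAt_fun_sum B fun b _ => hd b)
  have hfr : ∃ᶠ y in nhdsWithin x {x}ᶜ, maskFun B y = 0 := by
    rw [accPt_iff_frequently_nhdsNE] at hx
    exact hx.mono fun y hy => hy.2
  have := han.eqOn_zero_of_preconnected_of_frequently_eq_zero isPreconnected_univ
    (Set.mem_univ x) hfr (Set.mem_univ 0)
  rw [maskFun_zero hB] at this
  exact one_ne_zero this

theorem isExtremeCycle_zero {N : ℕ} {B L : Finset ℤ} (hB : B.Nonempty) (hL : (0 : ℤ) ∈ L) :
    IsExtremeCycle N B L {0} :=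
  ⟨0, fun _ => 0, fun _ => 0, by simp, fun _ => hL, fun _ => by simp [ifsMap],
    fun _ => by simp [maskFun_zero hB]⟩

/-- A continuous fixed point of the transfer operator that is at least `1` on the extreme cycles
is at least `1` everywhere. -/
theorem HasHadamardSums.one_le_of_transfer_eq {N : ℕ} {B L : Finset ℤ}
    (h : HasHadamardSums N B L) (hL : (0 : ℤ) ∈ L) {Q : ℝ → ℝ} (hQ : Continuous Q)
    (htr : ∀ t, Q t = ∑ l ∈ L, ‖maskFun B (ifsMap N l t)‖ ^ 2 * Q (ifsMap N l t))
    (hcyc : ∀ C, IsExtremeCycle N B L C → ∀ x ∈ C, 1 ≤ Q x) (t : ℝ) : 1 ≤ Q t := by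
  have hB : B.Nonempty := Finset.card_pos.1 (by have := h.two_le_card; omega)
  have hN2 : (2 : ℝ) ≤ N := by exact_mod_cast h.two_le
  have hN0 : (0 : ℝ) < N := by linarith
  have hQ0 : 1 ≤ Q 0 := hcyc _ (isExtremeCycle_zero hB hL) 0 rfl
  by_contra hlt
  push Not at hlt
  -- This K makes [−K, K] contain t and be stable under all τ_ℓ.
  let K : ℝ := |t| + ∑ l ∈ L, |(l : ℝ)|
  have hK : ∀ l ∈ L, |(l : ℝ)| ≤ K := fun l hl =>
    (Finset.single_le_sum (f := fun l : ℤ => |(l : ℝ)|) (fun _ _ => abs_nonneg _) hl).trans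
      (le_add_of_nonneg_left (abs_nonneg _))
  have htK : t ∈ Set.Icc (-K) K :=
    abs_le.1 (le_add_of_nonneg_right (Finset.sum_nonneg fun _ _ => abs_nonneg _))
  have hmaps : ∀ l ∈ L, ∀ z ∈ Set.Icc (-K) K, ifsMap N l z ∈ Set.Icc (-K) K := by
    intro l hl z hz
    have h1 := abs_le.1 (hK l hl)
    have hK0 : 0 ≤ K := (abs_nonneg _).trans (hK l hl)
    rw [ifsMap, Set.mem_Icc, le_div_iff₀ hN0, div_le_iff₀ hN0]
    constructor <;> nlinarith [hz.1, hz.2]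
  obtain ⟨z₀, hz₀, hmin⟩ := isCompact_Icc.exists_isMinOn ⟨t, htK⟩ hQ.continuousOn
  have hmin : ∀ z ∈ Set.Icc (-K) K, Q z₀ ≤ Q z := fun z hz => hmin hz
  have hm1 : Q z₀ < 1 := (hmin t htK).trans_lt hlt
  let Z : Set ℝ := {z | z ∈ Set.Icc (-K) K ∧ Q z = Q z₀}
  have hZstep : ∀ z ∈ Z, ∀ l ∈ L, maskFun B (ifsMap N l z) ≠ 0 → ifsMap N l z ∈ Z := by
    rintro z ⟨hzI, hzQ⟩ l hl hne
    refine ⟨hmaps l hl z hzI, ?_⟩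
    have h1 : ∑ l ∈ L, ‖maskFun B (ifsMap N l z)‖ ^ 2 * (Q (ifsMap N l z) - Q z₀) = 0 := by
      simp_rw [mul_sub]
      rw [Finset.sum_sub_distrib, ← htr z, ← Finset.sum_mul, h.sum_norm_maskFun_sq, hzQ]
      ring
    have h2 := (Finset.sum_eq_zero_iff_of_nonneg fun l hl =>
      mul_nonneg (sq_nonneg _) (sub_nonneg.2 (hmin _ (hmaps l hl z hzI)))).1 h1 l hl
    rcases mul_eq_zero.1 h2 with h3 | h3
    · exact absurd (norm_eq_zero.1 (pow_eq_zero_iff two_ne_zero |>.1 h3)) hne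
    · exact sub_eq_zero.1 h3
  -- Otherwise the digit 0 would keep z/N^k in Z for all k, and continuity would give Q(0) = Q(z₀) <
  -- 1, although {0} is an extreme cycle.
  have hZzero : ∀ z ∈ Z, ∃ k : ℕ, maskFun B (z / (N : ℝ) ^ (k + 1)) = 0 := by
    intro z hz
    by_contra hc
    push Not at hc
    have hmem : ∀ k : ℕ, z / (N : ℝ) ^ k ∈ Z := by
      intro k
      induction k with
      | zero => simpa using hz
      | succ k ih =>
        have h1 : ifsMap N 0 (z / (N : ℝ) ^ k) = z / (N : ℝ) ^ (k + 1) := by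
          rw [ifsMap, Int.cast_zero, add_zero, div_div, pow_succ]
        rw [← h1]
        exact hZstep _ ih 0 hL (by rw [h1]; exact hc k)
    have hlim : Filter.Tendsto (fun n : ℕ => z / (N : ℝ) ^ n) Filter.atTop (nhds 0) :=
      (tendsto_pow_atTop_atTop_of_one_lt (by linarith)).const_div_atTop z
    have h2 := (hQ.tendsto 0).comp hlim
    have h3 : Q ∘ (fun n : ℕ => z / (N : ℝ) ^ n) = fun _ => Q z₀ := funext fun n => (hmem n).2
    rw [h3] at h2
    have := tendsto_nhds_unique h2 tendsto_const_nhds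
    linarith
  -- Near 0 the mask does not vanish, so only finitely many k matter and Z is finite.
  obtain ⟨k₀, hk₀⟩ : ∃ k₀ : ℕ, ∀ k ≥ k₀, ∀ z ∈ Set.Icc (-K) K,
      maskFun B (z / (N : ℝ) ^ (k + 1)) ≠ 0 := by
    have hev : ∀ᶠ x in nhds (0 : ℝ), maskFun B x ≠ 0 :=
      (continuous_maskFun B).continuousAt.eventually_ne (by rw [maskFun_zero hB]; exact one_ne_zero)
    obtain ⟨δ, hδ, hball⟩ := Metric.eventually_nhds_iff.1 hev
    have hlim : Filter.Tendsto (fun n : ℕ => K / (N : ℝ) ^ n) Filter.atTop (nhds 0) :=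
      (tendsto_pow_atTop_atTop_of_one_lt (by linarith)).const_div_atTop K
    obtain ⟨k₀, hk₀⟩ := Filter.eventually_atTop.1 (hlim.eventually (gt_mem_nhds hδ))
    refine ⟨k₀, fun k hk z hz => hball ?_⟩
    rw [Real.dist_eq, sub_zero, abs_div, abs_of_pos (by positivity : (0 : ℝ) < N ^ (k + 1))]
    refine lt_of_le_of_lt ?_ (hk₀ (k + 1) (by omega))
    gcongr
    exact abs_le.2 hz
  have hZfin : Z.Finite := by
    have hfin : (⋃ k ∈ Finset.range k₀, (fun z : ℝ => z / (N : ℝ) ^ (k + 1)) ⁻¹'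
        {x | x ∈ Set.Icc (-K) K ∧ maskFun B x = 0}).Finite := by
      refine Set.Finite.biUnion (Finset.finite_toSet _) fun k _ => ?_
      refine (finite_maskFun_zeros hB K).preimage (Function.Injective.injOn ?_)
      exact fun a b hab => (div_left_inj' (by positivity)).1 hab
    refine hfin.subset fun z hz => ?_
    obtain ⟨k, hk⟩ := hZzero z hz
    simp only [Set.mem_iUnion, Finset.mem_range, Set.mem_preimage]
    refine ⟨k, ?_, ?_, hk⟩
    · by_contra hc
      exact hk₀ k (not_lt.1 hc) z hz.1 hk
    · have h1 : (1 : ℝ) ≤ (N : ℝ) ^ (k + 1) := one_le_pow₀ (by linarith)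
      rw [Set.mem_Icc, ← abs_le, abs_div, abs_of_pos (by positivity : (0 : ℝ) < N ^ (k + 1))]
      exact (div_le_self (abs_nonneg _) h1).trans (abs_le.2 hz.1)
  obtain ⟨C, hC, x, hxC, hxZ⟩ := h.exists_isExtremeCycle_of_finite hZfin ⟨z₀, hz₀, rfl⟩ hZstep
  have := hcyc C hC x hxC
  rw [hxZ.2] at this
  linarith

/-! ### Exponentials in `L²(μ)` -/

/-- The finite measures g⁺μ and g⁻μ have the same characteristic function, hence coincide, and so do
their densities. -/
theorem ae_eq_zero_of_integral_mul_cexp_eq_zero_real {μ : Measure ℝ} [IsFiniteMeasure μ]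
    {g : ℝ → ℝ} (hg : Integrable g μ)
    (h : ∀ t : ℝ, ∫ x, (g x : ℂ) * Complex.exp (t * x * Complex.I) ∂μ = 0) : g =ᵐ[μ] 0 := by
  have hfin₁ := isFiniteMeasure_withDensity_ofReal hg.2
  have hfin₂ := isFiniteMeasure_withDensity_ofReal hg.neg.2
  have hm₁ : AEMeasurable (fun x => ENNReal.ofReal (g x)) μ := hg.aemeasurable.ennreal_ofReal
  have hm₂ : AEMeasurable (fun x => ENNReal.ofReal ((-g) x)) μ := hg.neg.aemeasurable.ennreal_ofReal
  have hchar : ∀ {k : ℝ → ℝ} (_ : Integrable k μ) (t : ℝ),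
      charFun (μ.withDensity fun x => ENNReal.ofReal (k x)) t
        = ∫ x, ((max (k x) 0 : ℝ) : ℂ) * Complex.exp (t * x * Complex.I) ∂μ := by
    intro k hk t
    rw [charFun_apply_real, integral_withDensity_eq_integral_toReal_smul₀
      hk.aemeasurable.ennreal_ofReal (by simp)]
    refine integral_congr_ae (Filter.Eventually.of_forall fun x => ?_)
    simp only [ENNReal.toReal_ofReal', Complex.real_smul]
  have hint : ∀ {k : ℝ → ℝ} (_ : Integrable k μ) (t : ℝ),
      Integrable (fun x => ((max (k x) 0 : ℝ) : ℂ) * Complex.exp (t * x * Complex.I)) μ := by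
    intro k hk t
    refine hk.pos_part.ofReal.mul_bdd (c := 1) (by fun_prop) (Filter.Eventually.of_forall fun x => ?_)
    rw [← Complex.ofReal_mul, Complex.norm_exp_ofReal_mul_I]
  have heq : (μ.withDensity fun x => ENNReal.ofReal (g x))
      = μ.withDensity fun x => ENNReal.ofReal ((-g) x) := by
    refine Measure.ext_of_charFun (funext fun t => ?_)
    rw [hchar hg, hchar hg.neg, ← sub_eq_zero, ← integral_sub (hint hg t) (hint hg.neg t), ← h t]
    refine integral_congr_ae (Filter.Eventually.of_forall fun x => ?_)
    simp only [← sub_mul, Pi.neg_apply, ← Complex.ofReal_sub]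
    congr 2
    rcases le_total (g x) 0 with hx | hx
    · rw [max_eq_right hx, max_eq_left (by linarith)]; ring
    · rw [max_eq_left hx, max_eq_right (by linarith)]; ring
  have hlt : ∫⁻ x, ENNReal.ofReal (g x) ∂μ ≠ ⊤ := by
    refine ne_top_of_le_ne_top hg.2.ne (lintegral_mono fun x => ?_)
    exact Real.ofReal_le_enorm _
  filter_upwards [(withDensity_eq_iff hm₁ hm₂ hlt).1 heq] with x hx
  rcases lt_trichotomy (g x) 0 with h0 | h0 | h0
  · rw [ENNReal.ofReal_of_nonpos h0.le, eq_comm, ENNReal.ofReal_eq_zero, Pi.neg_apply] at hx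
    linarith
  · exact h0
  · rw [Pi.neg_apply, ENNReal.ofReal_of_nonpos (p := -g x) (by linarith),
      ENNReal.ofReal_eq_zero] at hx
    linarith

theorem ae_eq_zero_of_integral_mul_unitExp_eq_zero {μ : Measure ℝ} [IsFiniteMeasure μ]
    {f : ℝ → ℂ} (hf : Integrable f μ) (h : ∀ t : ℝ, ∫ x, f x * unitExp (t * x) ∂μ = 0) :
    f =ᵐ[μ] 0 := by
  have hpi : (2 * Real.pi : ℝ) ≠ 0 := by positivity
  have hexp : ∀ t x : ℝ, Complex.exp (t * x * Complex.I) = unitExp (t / (2 * Real.pi) * x) := by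
    intro t x
    rw [unitExp_eq_exp_ofReal_mul_I, ← Complex.ofReal_mul]
    congr 3
    field_simp
  -- Conjugation exchanges t and −t, so the hypothesis passes to the conjugate of f, and hence to
  -- its real and imaginary parts.
  have hconj : ∀ t : ℝ, ∫ x, (starRingEnd ℂ) (f x) * unitExp (t * x) ∂μ = 0 := by
    intro t
    rw [← map_zero (starRingEnd ℂ), ← h (-t), ← integral_conj]
    refine integral_congr_ae (Filter.Eventually.of_forall fun x => ?_)
    simp only [map_mul, neg_mul, unitExp_neg, Complex.conj_conj]
  have hint : ∀ {k : ℝ → ℂ} (_ : Integrable k μ) (t : ℝ),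
      Integrable (fun x => k x * unitExp (t * x)) μ := by
    intro k hk t
    refine hk.mul_bdd (c := 1) ?_ (Filter.Eventually.of_forall fun x => by simp)
    exact (continuous_unitExp.comp (continuous_const.mul continuous_id)).aestronglyMeasurable
  have hfc : Integrable (fun x => (starRingEnd ℂ) (f x)) μ :=
    Complex.conjCLE.toContinuousLinearMap.integrable_comp hf
  have hre : (fun x => (f x).re) =ᵐ[μ] 0 := by
    refine ae_eq_zero_of_integral_mul_cexp_eq_zero_real hf.re fun t => ?_
    simp_rw [hexp]
    have h1 : ∀ x, ((f x).re : ℂ) * unitExp (t / (2 * Real.pi) * x)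
        = 1 / 2 * (f x * unitExp (t / (2 * Real.pi) * x)
          + (starRingEnd ℂ) (f x) * unitExp (t / (2 * Real.pi) * x)) := by
      intro x
      rw [Complex.re_eq_add_conj]
      ring
    simp_rw [h1]
    rw [integral_const_mul, integral_add (hint hf _) (hint hfc _), h, hconj]
    simp
  have him : (fun x => (f x).im) =ᵐ[μ] 0 := by
    refine ae_eq_zero_of_integral_mul_cexp_eq_zero_real hf.im fun t => ?_
    simp_rw [hexp]
    have h1 : ∀ x, ((f x).im : ℂ) * unitExp (t / (2 * Real.pi) * x)
        = 1 / (2 * Complex.I) * (f x * unitExp (t / (2 * Real.pi) * x)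
          - (starRingEnd ℂ) (f x) * unitExp (t / (2 * Real.pi) * x)) := by
      intro x
      rw [Complex.im_eq_sub_conj]
      ring
    simp_rw [h1]
    rw [integral_const_mul, integral_sub (hint hf _) (hint hfc _), h, hconj]
    simp
  filter_upwards [hre, him] with x h1 h2
  exact Complex.ext h1 h2

theorem memLp_unitExp (μ : Measure ℝ) [IsFiniteMeasure μ] (t : ℝ) :
    MemLp (fun x => unitExp (t * x)) 2 μ :=
  MemLp.of_bound (continuous_unitExp.comp (continuous_const.mul continuous_id)).aestronglyMeasurable
    1 (Filter.Eventually.of_forall fun x => by simp)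

/-- The exponential `x ↦ e^{2πitx}` as an element of `L²(μ)`. -/
noncomputable def expLp (μ : Measure ℝ) [IsFiniteMeasure μ] (t : ℝ) : Lp ℂ 2 μ :=
  (memLp_unitExp μ t).toLp _

theorem coeFn_expLp (μ : Measure ℝ) [IsFiniteMeasure μ] (t : ℝ) :
    (expLp μ t : ℝ → ℂ) =ᵐ[μ] fun x => unitExp (t * x) := MemLp.coeFn_toLp _

/-- The Fourier transform `t ↦ ∫ e^{2πitx} dμ(x)`. -/
noncomputable def fourierHat (μ : Measure ℝ) (t : ℝ) : ℂ := ∫ x, unitExp (t * x) ∂μ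

theorem fourierHat_eq_charFun (μ : Measure ℝ) (t : ℝ) :
    fourierHat μ t = charFun μ (2 * Real.pi * t) := by
  rw [fourierHat, charFun_apply_real]
  refine integral_congr_ae (Filter.Eventually.of_forall fun x => ?_)
  simp only [unitExp]
  push_cast
  ring_nf

theorem fourierHat_zero (μ : Measure ℝ) [IsProbabilityMeasure μ] : fourierHat μ 0 = 1 := by
  simp [fourierHat]

theorem continuous_fourierHat (μ : Measure ℝ) [IsFiniteMeasure μ] : Continuous (fourierHat μ) := by
  have : fourierHat μ = fun t => charFun μ (2 * Real.pi * t) := funext (fourierHat_eq_charFun μ)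
  rw [this]
  exact continuous_charFun.comp (continuous_const.mul continuous_id)

theorem inner_expLp (μ : Measure ℝ) [IsFiniteMeasure μ] (s t : ℝ) :
    inner ℂ (expLp μ s) (expLp μ t) = fourierHat μ (t - s) := by
  rw [L2.inner_def, fourierHat]
  refine integral_congr_ae ?_
  filter_upwards [coeFn_expLp μ s, coeFn_expLp μ t] with x h1 h2
  rw [h1, h2, RCLike.inner_apply, sub_mul, unitExp_sub]

theorem norm_expLp (μ : Measure ℝ) [IsProbabilityMeasure μ] (t : ℝ) : ‖expLp μ t‖ = 1 := by
  have h := inner_self_eq_norm_sq (𝕜 := ℂ) (expLp μ t)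
  rw [inner_expLp, sub_self, fourierHat_zero, RCLike.one_re] at h
  exact (pow_eq_one_iff_of_nonneg (norm_nonneg _) two_ne_zero).1 h.symm

/-- For unit vectors ‖e_t − e_s‖² = 2 − 2 Re μ̂(s − t), and μ̂ is continuous. -/
theorem continuous_expLp (μ : Measure ℝ) [IsProbabilityMeasure μ] : Continuous (expLp μ) := by
  refine continuous_iff_continuousAt.2 fun s => ?_
  rw [ContinuousAt, tendsto_iff_norm_sub_tendsto_zero]
  have hsq : ∀ t, ‖expLp μ t - expLp μ s‖ = Real.sqrt (2 - 2 * (fourierHat μ (s - t)).re) := by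
    intro t
    have h1 := norm_sub_sq (𝕜 := ℂ) (expLp μ t) (expLp μ s)
    rw [inner_expLp, norm_expLp, norm_expLp] at h1
    rw [← Real.sqrt_sq (norm_nonneg (expLp μ t - expLp μ s)), h1]
    congr 1
    simp only [RCLike.re_to_complex]
    ring
  simp_rw [hsq]
  have hc : Continuous fun t => Real.sqrt (2 - 2 * (fourierHat μ (s - t)).re) := by
    have := continuous_fourierHat μ
    fun_prop
  have h0 := hc.tendsto s
  simpa [fourierHat_zero] using h0

theorem eq_zero_of_forall_inner_expLp {μ : Measure ℝ} [IsFiniteMeasure μ] {f : Lp ℂ 2 μ}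
    (h : ∀ t, inner ℂ f (expLp μ t) = 0) : f = 0 := by
  have hf : Integrable (f : ℝ → ℂ) μ := (Lp.memLp f).integrable (by norm_num)
  have hfc : Integrable (fun x => (starRingEnd ℂ) (f x)) μ :=
    Complex.conjCLE.toContinuousLinearMap.integrable_comp hf
  have h0 := ae_eq_zero_of_integral_mul_unitExp_eq_zero hfc fun t => by
    rw [← h t, L2.inner_def]
    refine integral_congr_ae ?_
    filter_upwards [coeFn_expLp μ t] with x hx
    rw [hx, RCLike.inner_apply, mul_comm]
  rw [Lp.eq_zero_iff_ae_eq_zero]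
  filter_upwards [h0] with x hx
  simpa using hx

/-- Parseval's identity for the projection on the closed span of an orthonormal family. -/
theorem Orthonormal.hasSum_norm_inner_sq {ι E : Type*} [NormedAddCommGroup E]
    [InnerProductSpace ℂ E] [CompleteSpace E] {v : ι → E} (hv : Orthonormal ℂ v) (x : E) :
    HasSum (fun i => ‖inner ℂ (v i) x‖ ^ 2)
      (‖(Submodule.span ℂ (Set.range v)).topologicalClosure.starProjection x‖ ^ 2) := by
  set K := (Submodule.span ℂ (Set.range v)).topologicalClosure with hK
  have hvK : ∀ i, v i ∈ K := fun i =>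
    Submodule.le_topologicalClosure _ (Submodule.subset_span ⟨i, rfl⟩)
  let w : ι → K := fun i => ⟨v i, hvK i⟩
  have hw : Orthonormal ℂ w := by
    rw [← K.subtypeₗᵢ.orthonormal_comp_iff]
    exact hv
  have hbot : (Submodule.span ℂ (Set.range w))ᗮ = ⊥ := by
    rw [Submodule.eq_bot_iff]
    intro y hy
    have h1 : (y : E) ∈ Kᗮ := by
      refine (Submodule.orthogonal_closure (Submodule.span ℂ (Set.range v))).ge
        ((Submodule.mem_orthogonal _ _).2 fun u hu => ?_)
      induction hu using Submodule.span_induction with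
      | mem u hu =>
        obtain ⟨i, rfl⟩ := hu
        exact (Submodule.mem_orthogonal _ _).1 hy (w i) (Submodule.subset_span ⟨i, rfl⟩)
      | zero => simp
      | add u u' _ _ h h' => rw [inner_add_left, h, h', add_zero]
      | smul c u _ h => rw [inner_smul_left, h, mul_zero]
    have h2 : inner ℂ (y : E) (y : E) = 0 := (Submodule.mem_orthogonal _ _).1 h1 y y.2
    exact Subtype.ext (inner_self_eq_zero.1 h2)
  let b := HilbertBasis.mkOfOrthogonalEqBot hw hbot
  have hb : ∀ i, b i = w i := fun i => by rw [HilbertBasis.coe_mkOfOrthogonalEqBot]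
  let y : K := K.orthogonalProjectionOnto x
  have hy : (y : E) = K.starProjection x := rfl
  have hs := b.hasSum_inner_mul_inner y y
  have hterm : ∀ i, inner ℂ y (b i) * inner ℂ (b i) y = ((‖inner ℂ (v i) x‖ ^ 2 : ℝ) : ℂ) := by
    intro i
    have h1 : inner ℂ (b i) y = inner ℂ (v i) x := by
      rw [hb, Submodule.coe_inner, hy, ← Submodule.inner_starProjection_left_eq_right,
        Submodule.starProjection_eq_self_iff.2 (hvK i)]
    rw [← inner_conj_symm, h1, Complex.conj_mul']
    push_cast
    rfl
  simp_rw [hterm] at hs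
  rw [inner_self_eq_norm_sq_to_K] at hs
  have h3 : ‖y‖ = ‖K.starProjection x‖ := by rw [← hy]; rfl
  rw [h3] at hs
  have hs' : HasSum (fun i => ((‖inner ℂ (v i) x‖ ^ 2 : ℝ) : ℂ))
      ((‖K.starProjection x‖ ^ 2 : ℝ) : ℂ) := by
    rw [Complex.ofReal_pow]
    exact hs
  exact Complex.hasSum_ofReal.1 hs'

/-! ### The canonical spectral pair -/

theorem IsExtremeCycle.neg_mem_canonicalSpectrum {N : ℕ} {B L : Finset ℤ} {C : Set ℝ}
    (hC : IsExtremeCycle N B L C) {x : ℝ} (hx : x ∈ C) : -x ∈ canonicalSpectrum N B L :=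
  Set.mem_sInter.2 fun _ hS => hS.1 C hC x hx

theorem mul_add_mem_canonicalSpectrum {N : ℕ} {B L : Finset ℤ} {s : ℝ}
    (hs : s ∈ canonicalSpectrum N B L) {l : ℤ} (hl : l ∈ L) :
    (N : ℝ) * s + l ∈ canonicalSpectrum N B L :=
  Set.mem_sInter.2 fun S hS => hS.2 s (Set.mem_sInter.1 hs S hS) l hl

theorem canonicalSpectrum_subset {N : ℕ} {B L : Finset ℤ} {S : Set ℝ}
    (hcyc : ∀ C, IsExtremeCycle N B L C → ∀ x ∈ C, -x ∈ S)
    (hstep : ∀ s ∈ S, ∀ l ∈ L, (N : ℝ) * s + (l : ℝ) ∈ S) : canonicalSpectrum N B L ⊆ S :=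
  Set.sInter_subset_of_mem ⟨hcyc, hstep⟩

theorem IsExtremeCycle.forall_int {N : ℕ} {B L : Finset ℤ} (h0 : (0 : ℤ) ∈ B) {C : Set ℝ}
    (hC : IsExtremeCycle N B L C) {x : ℝ} (hx : x ∈ C) : ∀ b ∈ B, ∃ n : ℤ, (b : ℝ) * x = n := by
  obtain ⟨k, y, l, rfl, -, -, h1⟩ := hC
  obtain ⟨j, rfl⟩ := hx
  exact forall_int_of_norm_maskFun_eq_one h0 (h1 j)

/-- The set of s with Bs ⊂ ℤ contains −C for every cycle and is stable under s ↦ Ns + ℓ, so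
minimality applies. Consequently Λ is countable and its elements are periods of m_B. -/
theorem forall_int_of_mem_canonicalSpectrum {N : ℕ} {B L : Finset ℤ} (h0 : (0 : ℤ) ∈ B) {s : ℝ}
    (hs : s ∈ canonicalSpectrum N B L) : ∀ b ∈ B, ∃ n : ℤ, (b : ℝ) * s = n := by
  refine canonicalSpectrum_subset (S := {s : ℝ | ∀ b ∈ B, ∃ n : ℤ, (b : ℝ) * s = n})
    (fun C hC x hx b hb => ?_) (fun s hs l _ b hb => ?_) hs
  · obtain ⟨n, hn⟩ := hC.forall_int h0 hx b hb
    exact ⟨-n, by push_cast; linarith⟩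
  · obtain ⟨n, hn⟩ := hs b hb
    refine ⟨N * n + b * l, ?_⟩
    push_cast
    linear_combination (N : ℝ) * hn

theorem exists_eq_mul_add_of_mem_canonicalSpectrum {N : ℕ} (hN : N ≠ 0) {B L : Finset ℤ} {s : ℝ}
    (hs : s ∈ canonicalSpectrum N B L) :
    ∃ s' ∈ canonicalSpectrum N B L, ∃ l ∈ L, s = N * s' + l := by
  have hN0 : (N : ℝ) ≠ 0 := by exact_mod_cast hN
  refine (canonicalSpectrum_subset (S := {s : ℝ | s ∈ canonicalSpectrum N B L ∧
    ∃ s' ∈ canonicalSpectrum N B L, ∃ l ∈ L, s = N * s' + (l : ℤ)})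
    (fun C hC x hx => ?_) (fun s hs l hl => ?_) hs).2
  · refine ⟨hC.neg_mem_canonicalSpectrum hx, ?_⟩
    have hC' := hC
    obtain ⟨k, y, l, rfl, hl, hstep, -⟩ := hC
    obtain ⟨j, rfl⟩ := hx
    -- The cycle relation x_{j+1} = (x_j + ℓ_j)/N reads −x_j = N(−x_{j+1}) + ℓ_j, so cycle points
    -- too have a last digit.
    refine ⟨-y (j + 1), hC'.neg_mem_canonicalSpectrum ⟨_, rfl⟩, l j, hl j, ?_⟩
    have := hstep j
    rw [ifsMap, div_eq_iff hN0] at this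
    linarith
  · exact ⟨mul_add_mem_canonicalSpectrum hs.1 hl, s, hs.1, l, hl, rfl⟩

theorem HasHadamardSums.exists_ne_zero_mem {N : ℕ} {B L : Finset ℤ} (h : HasHadamardSums N B L) :
    ∃ b ∈ B, b ≠ 0 := by
  obtain ⟨b, hb, b', hb', hne⟩ := Finset.one_lt_card.1 (by have := h.two_le_card; omega : 1 < B.card)
  rcases eq_or_ne b 0 with rfl | h0
  · exact ⟨b', hb', hne.symm⟩
  · exact ⟨b, hb, h0⟩

theorem HasHadamardSums.countable_canonicalSpectrum {N : ℕ} {B L : Finset ℤ}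
    (h : HasHadamardSums N B L) (h0 : (0 : ℤ) ∈ B) : (canonicalSpectrum N B L).Countable := by
  obtain ⟨b, hb, hb0⟩ := h.exists_ne_zero_mem
  have hb0 : (b : ℝ) ≠ 0 := by exact_mod_cast hb0
  refine (Set.countable_range fun n : ℤ => (n : ℝ) / b).mono fun s hs => ?_
  obtain ⟨n, hn⟩ := forall_int_of_mem_canonicalSpectrum h0 hs b hb
  exact ⟨n, by simp only [← hn]; field_simp⟩

theorem maskFun_sub_of_mem_canonicalSpectrum {N : ℕ} {B L : Finset ℤ} (h0 : (0 : ℤ) ∈ B) {s s' : ℝ}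
    (hs : s ∈ canonicalSpectrum N B L) (hs' : s' ∈ canonicalSpectrum N B L) (x : ℝ) :
    maskFun B (x + (s - s')) = maskFun B x := by
  refine maskFun_add_of_forall_int (fun b hb => ?_) x
  obtain ⟨n, hn⟩ := forall_int_of_mem_canonicalSpectrum h0 hs b hb
  obtain ⟨n', hn'⟩ := forall_int_of_mem_canonicalSpectrum h0 hs' b hb
  exact ⟨n - n', by push_cast; linarith⟩

/-! ### Orthogonality of the exponentials -/

theorem IsSelfSimilarMeasure.fourierHat_eq {N : ℕ} {B : Finset ℤ} {μ : Measure ℝ}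
    (h : IsSelfSimilarMeasure N B μ) (t : ℝ) :
    fourierHat μ t = maskFun B (t / N) * fourierHat μ (t / N) := by
  rw [fourierHat_eq_charFun, fourierHat_eq_charFun, h.charFun_eq, ← Finset.sum_mul, ← mul_assoc,
    maskFun_eq]
  have hsum : ∑ b ∈ B, Complex.exp ((2 * Real.pi * t : ℝ) * (b / N) * Complex.I)
      = ∑ b ∈ B, unitExp (b * (t / N)) := by
    refine Finset.sum_congr rfl fun b _ => ?_
    rw [unitExp]
    push_cast
    ring_nf
  rw [hsum, mul_div_assoc]

/-- Descent on the integer |b(s − s')| for a fixed b ≠ 0. Different last digits produce the factor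
m_B((ℓ − ℓ')/N) = 0; equal ones can be removed, which divides the difference by N ≥ 2. -/
theorem HasHadamardSums.fourierHat_sub_eq_zero {N : ℕ} {B L : Finset ℤ}
    (h : HasHadamardSums N B L) (h0 : (0 : ℤ) ∈ B) {μ : Measure ℝ}
    (hμ : IsSelfSimilarMeasure N B μ) {s s' : ℝ} (hs : s ∈ canonicalSpectrum N B L)
    (hs' : s' ∈ canonicalSpectrum N B L) (hne : s ≠ s') : fourierHat μ (s - s') = 0 := by
  have hN2 : (2 : ℝ) ≤ N := by exact_mod_cast h.two_le
  have hN0 : (N : ℝ) ≠ 0 := by positivity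
  have hNn : N ≠ 0 := by exact_mod_cast hN0
  obtain ⟨b, hb, hb0⟩ := h.exists_ne_zero_mem
  obtain ⟨n, hn⟩ : ∃ n : ℕ, |(b : ℝ) * (s - s')| < 2 ^ n :=
    pow_unbounded_of_one_lt _ one_lt_two
  induction n generalizing s s' with
  | zero =>
    obtain ⟨m, hm⟩ := forall_int_of_mem_canonicalSpectrum h0 hs b hb
    obtain ⟨m', hm'⟩ := forall_int_of_mem_canonicalSpectrum h0 hs' b hb
    rw [mul_sub, hm, hm', pow_zero, ← Int.cast_sub, ← Int.cast_abs] at hn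
    have h1 : |m - m'| < 1 := by exact_mod_cast hn
    have h2 : m = m' := by rw [Int.abs_lt_one_iff] at h1; omega
    exfalso
    refine hne (mul_left_cancel₀ (by exact_mod_cast hb0 : (b : ℝ) ≠ 0) ?_)
    rw [hm, hm', h2]
  | succ n ih =>
    obtain ⟨r, hr, l, hl, rfl⟩ := exists_eq_mul_add_of_mem_canonicalSpectrum hNn hs
    obtain ⟨r', hr', l', hl', rfl⟩ := exists_eq_mul_add_of_mem_canonicalSpectrum hNn hs'
    have hdiv : ((N : ℝ) * r + l - (N * r' + l')) / N = ((l - l' : ℤ) : ℝ) / N + (r - r') := by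
      push_cast
      field_simp
      ring
    rw [hμ.fourierHat_eq, hdiv, maskFun_sub_of_mem_canonicalSpectrum h0 hr hr']
    rcases eq_or_ne l l' with rfl | hll
    · simp only [sub_self, Int.cast_zero, zero_div, zero_add]
      rw [ih hr hr' (fun e => hne (by rw [e])), mul_zero]
      have h3 : |(b : ℝ) * (N * r + l - (N * r' + l))| = N * |(b : ℝ) * (r - r')| := by
        rw [show (b : ℝ) * (N * r + l - (N * r' + l)) = N * (b * (r - r')) by ring, abs_mul,
          Nat.abs_cast]
      rw [h3, pow_succ] at hn
      nlinarith [abs_nonneg ((b : ℝ) * (r - r'))]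
    · rw [h.maskFun_sub_div hl hl' hll, zero_mul]

theorem HasHadamardSums.orthonormal_expLp {N : ℕ} {B L : Finset ℤ}
    (h : HasHadamardSums N B L) (h0 : (0 : ℤ) ∈ B) {μ : Measure ℝ} [IsProbabilityMeasure μ]
    (hμ : IsSelfSimilarMeasure N B μ) :
    Orthonormal ℂ fun s : canonicalSpectrum N B L => expLp μ s := by
  refine ⟨fun s => norm_expLp μ s, fun s s' hne => ?_⟩
  simp only [inner_expLp]
  exact h.fourierHat_sub_eq_zero h0 hμ s'.2 s.2 fun e => hne (Subtype.ext e.symm)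

/-- The bijection `(ℓ, s) ↦ N s + ℓ` of `L × Λ` with `Λ`. -/
noncomputable def HasHadamardSums.spectrumEquiv {N : ℕ} {B L : Finset ℤ}
    (h : HasHadamardSums N B L) (h0 : (0 : ℤ) ∈ B) :
    L × canonicalSpectrum N B L ≃ canonicalSpectrum N B L :=
  Equiv.ofBijective (fun z => ⟨N * z.2 + (z.1 : ℤ), mul_add_mem_canonicalSpectrum z.2.2 z.1.2⟩) <| by
    have hN0 : (N : ℝ) ≠ 0 := by have := h.two_le; positivity
    constructor
    · rintro ⟨⟨l, hl⟩, ⟨s, hs⟩⟩ ⟨⟨l', hl'⟩, ⟨s', hs'⟩⟩ he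
      simp only [Subtype.mk.injEq] at he
      have hll : l = l' := by
        by_contra hne
        have h1 := h.maskFun_sub_div hl hl' hne
        -- The point (ℓ − ℓ')/N would be a difference of elements of Λ, hence a period of m_B, where
        -- m_B is 1 rather than 0.
        have h2 : ((l - l' : ℤ) : ℝ) / N = 0 + (s' - s) := by
          push_cast
          field_simp
          linarith
        rw [h2, maskFun_sub_of_mem_canonicalSpectrum h0 hs' hs, maskFun_zero ⟨0, h0⟩] at h1
        exact one_ne_zero h1
      subst hll
      have : s = s' := by simpa [hN0] using he
      subst this
      rfl
    · rintro ⟨s, hs⟩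
      obtain ⟨s', hs', l, hl, rfl⟩ := exists_eq_mul_add_of_mem_canonicalSpectrum
        (by have := h.two_le; omega) hs
      exact ⟨⟨⟨l, hl⟩, ⟨s', hs'⟩⟩, rfl⟩

/-! ### Completeness of the exponentials -/

theorem HasHadamardSums.isSpectralPair {N : ℕ} {B L : Finset ℤ} (h : HasHadamardSums N B L)
    (hB0 : (0 : ℤ) ∈ B) (hL0 : (0 : ℤ) ∈ L) :
    IsSpectralPair (selfSimilarMeasure N B) (canonicalSpectrum N B L) := by
  have hN0 : (N : ℝ) ≠ 0 := by have := h.two_le; positivity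
  have hμ := isSelfSimilarMeasure_selfSimilarMeasure h.two_le ⟨0, hB0⟩
  set μ := selfSimilarMeasure N B
  set Λ := canonicalSpectrum N B L with hΛ
  have := hμ.1
  have hon := h.orthonormal_expLp hB0 hμ
  let v : Λ → Lp ℂ 2 μ := fun s => expLp μ s
  let K := (Submodule.span ℂ (Set.range v)).topologicalClosure
  -- The sign turns Parseval's sum into ∑ |μ̂(t + s)|²; as a norm of a projection, Q is visibly
  -- continuous.
  let Q : ℝ → ℝ := fun t => ‖K.starProjection (expLp μ (-t))‖ ^ 2
  have hQs : ∀ t, HasSum (fun s : Λ => ‖fourierHat μ (t + s)‖ ^ 2) (Q t) := by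
    intro t
    convert hon.hasSum_norm_inner_sq (expLp μ (-t)) using 3 with s
    rw [← norm_inner_symm, inner_expLp]
    congr 2
    ring
  have hQc : Continuous Q :=
    ((K.starProjection.continuous.comp ((continuous_expLp μ).comp continuous_neg)).norm).pow 2
  have htr : ∀ t, Q t = ∑ l ∈ L, ‖maskFun B (ifsMap N l t)‖ ^ 2 * Q (ifsMap N l t) := by
    intro t
    -- Summation over Λ is split by the last digit; since m_B is Λ-periodic, its factor leaves the
    -- inner sum.
    have h1 := (h.spectrumEquiv hB0).hasSum_iff.2 (hQs t)
    have hterm : ∀ z : L × Λ, ((fun s : Λ => ‖fourierHat μ (t + s)‖ ^ 2) ∘ h.spectrumEquiv hB0) z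
        = ‖maskFun B (ifsMap N z.1 t)‖ ^ 2 * ‖fourierHat μ (ifsMap N z.1 t + z.2)‖ ^ 2 := by
      rintro ⟨l, s⟩
      have h2 : (t + (N * s + (l : ℤ))) / N = ifsMap N l t + (s : ℝ) := by
        rw [ifsMap]
        field_simp
        ring
      have h3 : maskFun B (ifsMap N l t + (s : ℝ)) = maskFun B (ifsMap N l t) :=
        maskFun_add_of_forall_int (forall_int_of_mem_canonicalSpectrum hB0 s.2) _
      change ‖fourierHat μ (t + (N * s + (l : ℤ)))‖ ^ 2 = _
      rw [hμ.fourierHat_eq, h2, h3, norm_mul, mul_pow]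
    rw [funext hterm] at h1
    have h4 := h1.prod_fiberwise fun l => (hQs (ifsMap N (l : L) t)).mul_left
      (‖maskFun B (ifsMap N (l : L) t)‖ ^ 2)
    rw [h4.unique (hasSum_fintype _)]
    exact Finset.sum_coe_sort L fun l => ‖maskFun B (ifsMap N l t)‖ ^ 2 * Q (ifsMap N l t)
  have hcyc : ∀ C, IsExtremeCycle N B L C → ∀ x ∈ C, 1 ≤ Q x := by
    intro C hC x hx
    -- The single term s = −x is |μ̂(0)|² = 1.
    have h1 := le_hasSum (hQs x) ⟨-x, hC.neg_mem_canonicalSpectrum hx⟩ fun _ _ => by positivity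
    simpa [fourierHat_zero] using h1
  have hQ1 : ∀ t, expLp μ t ∈ K := by
    intro t
    rw [Submodule.mem_iff_norm_starProjection]
    refine le_antisymm (K.norm_starProjection_apply_le _) ?_
    have h1 := h.one_le_of_transfer_eq hL0 hQc htr hcyc (-t)
    simp only [Q, neg_neg] at h1
    rw [norm_expLp]
    exact (one_le_sq_iff₀ (norm_nonneg _)).1 h1
  have hbot : (Submodule.span ℂ (Set.range v))ᗮ = ⊥ := by
    rw [← Submodule.orthogonal_closure, Submodule.eq_bot_iff]
    exact fun f hf => eq_zero_of_forall_inner_expLp fun t =>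
      (Submodule.mem_orthogonal' _ _).1 hf _ (hQ1 t)
  refine ⟨this, h.countable_canonicalSpectrum hB0, HilbertBasis.mkOfOrthogonalEqBot hon hbot,
    fun s => ?_⟩
  rw [HilbertBasis.coe_mkOfOrthogonalEqBot]
  refine (coeFn_expLp μ s).trans (Filter.Eventually.of_forall fun x => ?_)
  simp [unitExp]

/-! ### Multiples of the canonical spectrum -/

/-- A bounded set contained in the union of its images under the maps `τ_ℓ` is covered by `(#L)ⁿ`
intervals of radius comparable to `N⁻ⁿ`. -/
theorem exists_finset_cover {N : ℕ} (hN : N ≠ 0) (L : Finset ℤ) {C : Set ℝ} {T : ℝ}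
    (hT : ∀ x ∈ C, |x| ≤ T) (hC : ∀ x ∈ C, ∃ y ∈ C, ∃ l ∈ L, x = ifsMap N l y) (n : ℕ) :
    ∃ F : Finset ℝ, F.card ≤ L.card ^ n ∧ ∀ x ∈ C, ∃ c ∈ F, |x - c| ≤ T / (N : ℝ) ^ n := by
  classical
  have hN0 : (0 : ℝ) < N := by exact_mod_cast Nat.pos_of_ne_zero hN
  induction n with
  | zero => exact ⟨{0}, by simp, fun x hx => ⟨0, by simp, by simpa using hT x hx⟩⟩
  | succ n ih =>
    obtain ⟨F, hcard, hF⟩ := ih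
    refine ⟨(F ×ˢ L).image fun z => ifsMap N z.2 z.1, ?_, fun x hx => ?_⟩
    · refine Finset.card_image_le.trans ?_
      rw [Finset.card_product, pow_succ]
      exact Nat.mul_le_mul_right _ hcard
    · obtain ⟨y, hy, l, hl, rfl⟩ := hC x hx
      obtain ⟨c, hc, hyc⟩ := hF y hy
      refine ⟨ifsMap N l c, Finset.mem_image.2 ⟨(c, l), Finset.mem_product.2 ⟨hc, hl⟩, rfl⟩, ?_⟩
      have : ifsMap N l y - ifsMap N l c = (y - c) / N := by
        simp only [ifsMap]
        ring
      rw [this, abs_div, Nat.abs_cast, pow_succ, ← div_div]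
      gcongr

theorem card_int_le_of_cover {F : Finset ℝ} {r : ℝ} (hr : 0 ≤ r) {Y : Finset ℤ}
    (hY : ∀ n ∈ Y, ∃ c ∈ F, |(n : ℝ) - c| ≤ r) : (Y.card : ℝ) ≤ F.card * (2 * r + 1) := by
  classical
  have hsub : Y ⊆ F.biUnion fun c => Finset.Icc ⌈c - r⌉ ⌊c + r⌋ := by
    intro n hn
    obtain ⟨c, hc, hnc⟩ := hY n hn
    rw [abs_le] at hnc
    rw [Finset.mem_biUnion]
    refine ⟨c, hc, Finset.mem_Icc.2 ⟨Int.ceil_le.2 (by linarith), Int.le_floor.2 (by linarith)⟩⟩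
  have hone : ∀ c : ℝ, ((Finset.Icc ⌈c - r⌉ ⌊c + r⌋).card : ℝ) ≤ 2 * r + 1 := by
    intro c
    rw [Int.card_Icc]
    rcases le_total 0 (⌊c + r⌋ + 1 - ⌈c - r⌉) with h0 | h0
    · have h1 : (((⌊c + r⌋ + 1 - ⌈c - r⌉).toNat : ℤ) : ℝ) = ((⌊c + r⌋ + 1 - ⌈c - r⌉ : ℤ) : ℝ) := by
        rw [Int.toNat_of_nonneg h0]
      rw [Int.cast_natCast] at h1
      rw [h1]
      push_cast
      have := Int.floor_le (c + r)
      have := Int.le_ceil (c - r)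
      linarith
    · rw [Int.toNat_of_nonpos h0]
      simp only [Nat.cast_zero]
      positivity
  calc (Y.card : ℝ) ≤ ((∑ c ∈ F, (Finset.Icc ⌈c - r⌉ ⌊c + r⌋).card : ℕ) : ℝ) := by
        exact_mod_cast (Finset.card_le_card hsub).trans Finset.card_biUnion_le
    _ = ∑ c ∈ F, ((Finset.Icc ⌈c - r⌉ ⌊c + r⌋).card : ℝ) := by push_cast; rfl
    _ ≤ ∑ c ∈ F, (2 * r + 1) := Finset.sum_le_sum fun c _ => hone c
    _ = F.card * (2 * r + 1) := by rw [Finset.sum_const, nsmul_eq_mul]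

/-- A finite set of integers that is stable modulo `p` under multiplication by `N` and contains a
non-multiple of `p` has at least as many elements as the order of `N` modulo `p`. -/
theorem orderOf_le_card_of_mul_stable {N p : ℕ} (hp : p.Prime) {Y : Finset ℤ}
    (hY : ∀ n ∈ Y, ∃ n' ∈ Y, (n' : ZMod p) = N * n) {n₀ : ℤ} (hn₀ : n₀ ∈ Y) (hd : ¬ (p : ℤ) ∣ n₀) :
    orderOf (N : ZMod p) ≤ Y.card := by
  classical
  have := Fact.mk hp
  have h0 : (n₀ : ZMod p) ≠ 0 := fun h => hd ((ZMod.intCast_zmod_eq_zero_iff_dvd n₀ p).1 h)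
  have hmem : ∀ i : ℕ, (N : ZMod p) ^ i * n₀ ∈ Y.image fun n : ℤ => (n : ZMod p) := by
    intro i
    induction i with
    | zero => exact Finset.mem_image.2 ⟨n₀, hn₀, by simp⟩
    | succ i ih =>
      obtain ⟨n, hn, he⟩ := Finset.mem_image.1 ih
      obtain ⟨n', hn', he'⟩ := hY n hn
      exact Finset.mem_image.2 ⟨n', hn', by rw [he', he, pow_succ']; ring⟩
  have hinj : Set.InjOn (fun i : ℕ => (N : ZMod p) ^ i * n₀)
      (Finset.range (orderOf (N : ZMod p))) := by
    intro i hi j hj hij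
    rw [Finset.coe_range] at hi hj
    exact pow_injOn_Iio_orderOf hi hj (mul_right_cancel₀ h0 hij)
  calc orderOf (N : ZMod p) = ((Finset.range (orderOf (N : ZMod p))).image
        fun i : ℕ => (N : ZMod p) ^ i * n₀).card := by
        rw [Finset.card_image_of_injOn hinj, Finset.card_range]
    _ ≤ (Y.image fun n : ℤ => (n : ZMod p)).card := by
        refine Finset.card_le_card fun y hy => ?_
        obtain ⟨i, -, rfl⟩ := Finset.mem_image.1 hy
        exact hmem i
    _ ≤ Y.card := Finset.card_image_le

/-! ### Extreme cycles of the dilated digits pL -/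

theorem IsExtremeCycle.finite {N : ℕ} {B L : Finset ℤ} {C : Set ℝ} (hC : IsExtremeCycle N B L C) :
    C.Finite := by
  obtain ⟨k, x, l, rfl, -⟩ := hC
  exact Set.finite_range x

theorem IsExtremeCycle.exists_eq_ifsMap {N : ℕ} {B L : Finset ℤ} {C : Set ℝ}
    (hC : IsExtremeCycle N B L C) {x : ℝ} (hx : x ∈ C) : ∃ y ∈ C, ∃ l ∈ L, x = ifsMap N l y := by
  obtain ⟨k, x, l, rfl, hl, hstep, -⟩ := hC
  obtain ⟨j, rfl⟩ := hx
  refine ⟨x (j - 1), ⟨_, rfl⟩, l (j - 1), hl _, ?_⟩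
  rw [hstep, sub_add_cancel]

/-- A point z of largest modulus satisfies N|z| ≤ |z| + R. -/
theorem IsExtremeCycle.abs_le {N : ℕ} (hN : 2 ≤ N) {B L : Finset ℤ} {C : Set ℝ}
    (hC : IsExtremeCycle N B L C) {R : ℝ} (hR : ∀ l ∈ L, |(l : ℝ)| ≤ R) {x : ℝ} (hx : x ∈ C) :
    |x| ≤ R := by
  have hN2 : (2 : ℝ) ≤ N := by exact_mod_cast hN
  obtain ⟨z, hz, hmax⟩ := Set.exists_max_image C (fun x => |x|) hC.finite ⟨x, hx⟩
  refine (hmax x hx).trans ?_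
  obtain ⟨y, hy, l, hl, rfl⟩ := hC.exists_eq_ifsMap hz
  have h1 : |ifsMap N l y| * N = |y + l| := by
    rw [ifsMap, abs_div, Nat.abs_cast, div_mul_cancel₀ _ (by positivity)]
  have h2 := abs_add_le y l
  have h3 := hmax y hy
  have h4 := hR l hl
  have h5 := abs_nonneg (ifsMap N l y)
  nlinarith

/-- If `N` has large order modulo `p`, every extreme cycle of the digits `pL` is divisible
by `p`. -/
theorem IsExtremeCycle.exists_eq_prime_mul {N : ℕ} (hN : 2 ≤ N) {B L : Finset ℤ}
    (h0 : (0 : ℤ) ∈ B) {p : ℕ} (hp : p.Prime)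
    (hord : (L.card : ℝ) ^ Nat.clog N p *
      (2 * ((∑ b ∈ B, |(b : ℝ)|) * ∑ l ∈ L, |(l : ℝ)|) + 1) < orderOf (N : ZMod p))
    {C : Set ℝ} (hC : IsExtremeCycle N B (L.image fun l => (p : ℤ) * l) C) {x : ℝ} (hx : x ∈ C)
    {b : ℤ} (hb : b ∈ B) : ∃ n : ℤ, (b : ℝ) * x = p * n := by
  classical
  have hN0 : (0 : ℝ) < N := by positivity
  have hp0 : (0 : ℝ) < p := by exact_mod_cast hp.pos
  set R := ∑ l ∈ L, |(l : ℝ)| with hRdef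
  set D := ∑ b ∈ B, |(b : ℝ)| with hDdef
  have hR : ∀ l ∈ L, |(l : ℝ)| ≤ R := fun l hl =>
    Finset.single_le_sum (f := fun l : ℤ => |(l : ℝ)|) (fun _ _ => abs_nonneg _) hl
  have hD : |(b : ℝ)| ≤ D :=
    Finset.single_le_sum (f := fun b : ℤ => |(b : ℝ)|) (fun _ _ => abs_nonneg _) hb
  have hR0 : 0 ≤ R := Finset.sum_nonneg fun _ _ => abs_nonneg _
  have hT : ∀ x ∈ C, |x| ≤ p * R := fun x hx => by
    refine hC.abs_le hN (fun l hl => ?_) hx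
    obtain ⟨l', hl', rfl⟩ := Finset.mem_image.1 hl
    push_cast
    rw [abs_mul, Nat.abs_cast]
    exact mul_le_mul_of_nonneg_left (hR l' hl') hp0.le
  have hint : ∀ x ∈ C, ∃ n : ℤ, (b : ℝ) * x = n := fun x hx => hC.forall_int h0 hx b hb
  choose! f hf using hint
  let Y : Finset ℤ := hC.finite.toFinset.image f
  have hmemY : ∀ n, n ∈ Y ↔ ∃ x ∈ C, f x = n := by simp [Y]
  by_contra hc
  have hnd : ¬ (p : ℤ) ∣ f x := by
    rintro ⟨n, hn⟩
    refine hc ⟨n, ?_⟩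
    rw [hf x hx, hn]
    push_cast
    ring
  have hlow : orderOf (N : ZMod p) ≤ Y.card := by
    refine orderOf_le_card_of_mul_stable hp (fun n hn => ?_) ((hmemY _).2 ⟨x, hx, rfl⟩) hnd
    obtain ⟨z, hz, rfl⟩ := (hmemY n).1 hn
    obtain ⟨y, hy, l, hl, hzy⟩ := hC.exists_eq_ifsMap hz
    obtain ⟨l', hl', rfl⟩ := Finset.mem_image.1 hl
    refine ⟨f y, (hmemY _).2 ⟨y, hy, rfl⟩, ?_⟩
    -- The predecessor of z is y = Nz − pℓ', so modulo p going back one step multiplies by N.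
    have h1 : (f y : ℝ) = N * f z - p * (b * l') := by
      rw [← hf y hy, ← hf z hz, hzy, ifsMap]
      field_simp
      push_cast
      ring
    have h2 : f y = N * f z - p * (b * l') := by exact_mod_cast h1
    rw [h2]
    push_cast
    simp
  -- The depth is the least n with N^n ≥ p: it brings the radius pR/N^n down to R, independent of p.
  obtain ⟨F, hFcard, hF⟩ := exists_finset_cover (by omega : N ≠ 0) _ hT
    (fun x hx => hC.exists_eq_ifsMap hx) (Nat.clog N p)
  have hNp : (p : ℝ) ≤ (N : ℝ) ^ Nat.clog N p := by exact_mod_cast Nat.le_pow_clog (by omega) p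
  have hrad : p * R / (N : ℝ) ^ Nat.clog N p ≤ R := by
    rw [div_le_iff₀ (by positivity), mul_comm]
    exact mul_le_mul_of_nonneg_left hNp hR0
  have hup : (Y.card : ℝ) ≤ (F.image fun c => (b : ℝ) * c).card * (2 * (D * R) + 1) := by
    refine card_int_le_of_cover (mul_nonneg ((abs_nonneg _).trans hD) hR0) fun n hn => ?_
    obtain ⟨z, hz, rfl⟩ := (hmemY n).1 hn
    obtain ⟨c, hc, hzc⟩ := hF z hz
    refine ⟨b * c, Finset.mem_image.2 ⟨c, hc, rfl⟩, ?_⟩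
    rw [← hf z hz, ← mul_sub, abs_mul]
    exact mul_le_mul hD (hzc.trans hrad) (abs_nonneg _) ((abs_nonneg _).trans hD)
  have hcardF : ((F.image fun c => (b : ℝ) * c).card : ℝ) ≤ (L.card : ℝ) ^ Nat.clog N p := by
    have h1 := (Finset.card_image_le (s := F) (f := fun c => (b : ℝ) * c)).trans (hFcard.trans
      (Nat.pow_le_pow_left (Finset.card_image_le (s := L) (f := fun l => (p : ℤ) * l)) _))
    exact_mod_cast h1
  have hpos : 0 ≤ 2 * (D * R) + 1 := by
    have := mul_nonneg ((abs_nonneg _).trans hD) hR0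
    linarith
  have h5 : (orderOf (N : ZMod p) : ℝ) ≤ Y.card := by exact_mod_cast hlow
  have h6 := mul_le_mul_of_nonneg_right hcardF hpos
  linarith

/-- Since |m_B(x)| = 1 means Bx ⊂ ℤ, multiplying by p turns cycles for L into cycles for pL.
Dividing by p goes back provided Bx ⊂ pℤ, which is what `hdiv` supplies. -/
theorem canonicalSpectrum_image_mul {N : ℕ} (hN : N ≠ 0) {B L : Finset ℤ} (h0 : (0 : ℤ) ∈ B)
    {p : ℕ} (hp : p ≠ 0)
    (hdiv : ∀ C, IsExtremeCycle N B (L.image fun l => (p : ℤ) * l) C → ∀ x ∈ C, ∀ b ∈ B,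
      ∃ n : ℤ, (b : ℝ) * x = p * n) :
    canonicalSpectrum N B (L.image fun l => (p : ℤ) * l)
      = (fun s => (p : ℝ) * s) '' canonicalSpectrum N B L := by
  have hp0 : (p : ℝ) ≠ 0 := by exact_mod_cast hp
  have hN0 : (N : ℝ) ≠ 0 := by exact_mod_cast hN
  apply Set.Subset.antisymm
  · refine canonicalSpectrum_subset (fun C hC x hx => ?_) ?_
    · refine ⟨-(x / p), ?_, by field_simp⟩
      have hC' := hC
      obtain ⟨k, y, l, rfl, hl, hstep, -⟩ := hC
      simp only [Finset.mem_image] at hl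
      choose l' hl' hll' using hl
      have hcyc : IsExtremeCycle N B L (Set.range fun j => y j / p) := by
        refine ⟨k, fun j => y j / p, l', rfl, hl', fun j => ?_, fun j => ?_⟩
        · simp only [← hstep j, ← hll' j, ifsMap]
          push_cast
          field_simp
        · refine norm_maskFun_of_forall_int ⟨0, h0⟩ fun b hb => ?_
          obtain ⟨n, hn⟩ := hdiv _ hC' (y j) ⟨j, rfl⟩ b hb
          exact ⟨n, by rw [mul_div_assoc', hn]; field_simp⟩
      obtain ⟨j, rfl⟩ := hx
      exact hcyc.neg_mem_canonicalSpectrum ⟨j, rfl⟩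
    · rintro _ ⟨s, hs, rfl⟩ l hl
      obtain ⟨l', hl', rfl⟩ := Finset.mem_image.1 hl
      exact ⟨_, mul_add_mem_canonicalSpectrum hs hl', by push_cast; ring⟩
  · rw [Set.image_subset_iff]
    refine canonicalSpectrum_subset (fun C hC x hx => ?_) fun s hs l hl => ?_
    · have hC' := hC
      obtain ⟨k, y, l, rfl, hl, hstep, -⟩ := hC
      have hcyc : IsExtremeCycle N B (L.image fun l => (p : ℤ) * l)
          (Set.range fun j => (p : ℝ) * y j) := by
        refine ⟨k, fun j => p * y j, fun j => p * l j, rfl,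
          fun j => Finset.mem_image.2 ⟨l j, hl j, rfl⟩, fun j => ?_, fun j => ?_⟩
        · simp only [← hstep j, ifsMap]
          push_cast
          field_simp
        · refine norm_maskFun_of_forall_int ⟨0, h0⟩ fun b hb => ?_
          obtain ⟨n, hn⟩ := hC'.forall_int h0 ⟨j, rfl⟩ b hb
          exact ⟨p * n, by push_cast; rw [← hn]; ring⟩
      obtain ⟨j, rfl⟩ := hx
      have := hcyc.neg_mem_canonicalSpectrum ⟨j, rfl⟩
      simpa using this
    · have := mul_add_mem_canonicalSpectrum (Set.mem_preimage.1 hs)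
        (Finset.mem_image.2 ⟨l, hl, rfl⟩ : (p : ℤ) * l ∈ L.image fun l => (p : ℤ) * l)
      rw [Set.mem_preimage]
      convert this using 1
      push_cast
      ring

theorem HasHadamardSums.isSpectralEigenvalue_of_orderOf {N : ℕ} {B L : Finset ℤ}
    (h : HasHadamardSums N B L) (hB0 : (0 : ℤ) ∈ B) (hL0 : (0 : ℤ) ∈ L) {p : ℕ} (hp : p.Prime)
    (hord : (L.card : ℝ) ^ Nat.clog N p *
      (2 * ((∑ b ∈ B, |(b : ℝ)|) * ∑ l ∈ L, |(l : ℝ)|) + 1) < orderOf (N : ZMod p)) :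
    IsSpectralEigenvalue (selfSimilarMeasure N B) (canonicalSpectrum N B L) (p : ℝ) := by
  have := Fact.mk hp
  refine ⟨h.isSpectralPair hB0 hL0, ?_⟩
  rw [← canonicalSpectrum_image_mul (by have := h.two_le; omega) hB0 hp.ne_zero
    fun C hC x hx b hb => hC.exists_eq_prime_mul h.two_le hB0 hp hord hx hb]
  have hpos : 0 < orderOf (N : ZMod p) := by
    have h1 : (0 : ℝ) ≤ (L.card : ℝ) ^ Nat.clog N p *
        (2 * ((∑ b ∈ B, |(b : ℝ)|) * ∑ l ∈ L, |(l : ℝ)|) + 1) := by positivity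
    exact_mod_cast h1.trans_lt hord
  -- `orderOf 0 = 0`, so a positive order shows that p does not divide N.
  have hcop : p.Coprime N := by
    rw [hp.coprime_iff_not_dvd]
    intro hd
    rw [(ZMod.natCast_eq_zero_iff N p).2 hd, orderOf_zero] at hpos
    exact lt_irrefl _ hpos
  exact (h.image_mul hcop hp.ne_zero).isSpectralPair hB0 (Finset.mem_image.2 ⟨0, hL0, by simp⟩)

theorem HasHadamardSums.infinite_spectralEigenvalue {N : ℕ} {B L : Finset ℤ}
    (h : HasHadamardSums N B L) (hB0 : (0 : ℤ) ∈ B) (hL0 : (0 : ℤ) ∈ L) (hlt : B.card < N)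
    (hord : ∀ θ : ℝ, 0 < θ → θ < 1 →
      {p : ℕ | p.Prime ∧ (p : ℝ) ^ θ ≤ orderOf (N : ZMod p)}.Infinite) :
    {p : ℕ | p.Prime ∧ IsSpectralEigenvalue (selfSimilarMeasure N B)
      (canonicalSpectrum N B L) (p : ℝ)}.Infinite := by
  have hN2 := h.two_le
  have hM2 := h.two_le_card
  rw [h.card_eq] at hM2 hlt
  have hN1 : (1 : ℝ) < N := by exact_mod_cast (by omega : 1 < N)
  have hM1 : (1 : ℝ) < L.card := by exact_mod_cast (by omega : 1 < L.card)
  set κ : ℝ := 2 * ((∑ b ∈ B, |(b : ℝ)|) * ∑ l ∈ L, |(l : ℝ)|) + 1 with hκ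
  have hκ0 : 0 < κ := by positivity
  set σ : ℝ := Real.logb N L.card with hσ
  have hσ0 : 0 < σ := Real.logb_pos hN1 hM1
  have hσ1 : σ < 1 := by
    rw [hσ, Real.logb_lt_iff_lt_rpow hN1 (by linarith), Real.rpow_one]
    exact_mod_cast hlt
  have hNσ : (N : ℝ) ^ σ = L.card := Real.rpow_logb (by linarith) (by linarith) (by linarith)
  have hev : ∀ᶠ p : ℕ in Filter.atTop, L.card * κ < (p : ℝ) ^ ((1 - σ) / 2) :=
    ((tendsto_rpow_atTop (by linarith)).comp tendsto_natCast_atTop_atTop).eventually_gt_atTop _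
  obtain ⟨p₀, hp₀⟩ := Filter.eventually_atTop.1 hev
  -- The exponent is halfway between σ and 1: the cover bound is O(p^σ), and the spare factor
  -- p^((1−σ)/2) absorbs the constant.
  refine ((hord ((1 + σ) / 2) (by linarith) (by linarith)).sdiff (Set.finite_lt_nat p₀)).mono ?_
  rintro p ⟨⟨hp, hpo⟩, hpp⟩
  have hpp : p₀ ≤ p := not_lt.1 hpp
  refine ⟨hp, h.isSpectralEigenvalue_of_orderOf hB0 hL0 hp (lt_of_lt_of_le ?_ hpo)⟩
  have hp1 : (1 : ℝ) < p := by exact_mod_cast hp.one_lt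
  -- N^(clog − 1) < p, and raising to the power σ replaces N by #L; the rounding up costs one factor
  -- #L.
  have hclog : (L.card : ℝ) ^ Nat.clog N p ≤ L.card * (p : ℝ) ^ σ := by
    have h1 : Nat.clog N p = (Nat.clog N p - 1) + 1 := by
      have := Nat.clog_pos (by omega : 1 < N) hp.two_le
      omega
    have h2 : ((N : ℝ) ^ (Nat.clog N p - 1)) ≤ p := by
      have := Nat.pow_pred_clog_lt_self (by omega : 1 < N) hp.one_lt
      exact_mod_cast this.le
    rw [h1, pow_succ, mul_comm]
    refine mul_le_mul_of_nonneg_left ?_ (Nat.cast_nonneg _)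
    calc (L.card : ℝ) ^ (Nat.clog N p - 1) = ((N : ℝ) ^ (Nat.clog N p - 1)) ^ σ := by
          rw [← hNσ, ← Real.rpow_natCast, ← Real.rpow_natCast, ← Real.rpow_mul (by positivity),
            ← Real.rpow_mul (by positivity), mul_comm]
      _ ≤ (p : ℝ) ^ σ := by gcongr
  calc (L.card : ℝ) ^ Nat.clog N p * κ ≤ L.card * (p : ℝ) ^ σ * κ := by gcongr
    _ = (L.card * κ) * (p : ℝ) ^ σ := by ring
    _ < (p : ℝ) ^ ((1 - σ) / 2) * (p : ℝ) ^ σ :=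
        mul_lt_mul_of_pos_right (hp₀ p hpp) (by positivity)
    _ = (p : ℝ) ^ ((1 + σ) / 2) := by
        rw [← Real.rpow_add (by linarith)]
        ring_nf

/-! ### Large multiplicative orders from Artin's conjecture -/

/-- Square roots are extracted until none is left, because Artin's conjecture concerns nonsquares
only. -/
theorem exists_eq_pow_two_pow_not_isSquare (N : ℕ) (hN : 2 ≤ N) :
    ∃ a j : ℕ, 2 ≤ a ∧ ¬ IsSquare a ∧ N = a ^ 2 ^ j := by
  induction N using Nat.strong_induction_on with
  | _ N ih =>
    by_cases hsq : IsSquare N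
    · obtain ⟨r, rfl⟩ := hsq
      have hr : 2 ≤ r := by
        by_contra hc
        interval_cases r <;> omega
      obtain ⟨a, j, ha, hns, hr'⟩ := ih r (by nlinarith) hr
      refine ⟨a, j + 1, ha, hns, ?_⟩
      rw [hr', ← pow_add, pow_succ, mul_two]
    · exact ⟨N, 0, hN, hsq, by simp⟩

theorem ArtinPrimitiveRootConjecture.infinite_rpow_le_orderOf (h : ArtinPrimitiveRootConjecture)
    {N : ℕ} (hN : 2 ≤ N) {θ : ℝ} (hθ1 : θ < 1) :
    {p : ℕ | p.Prime ∧ (p : ℝ) ^ θ ≤ orderOf (N : ZMod p)}.Infinite := by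
  obtain ⟨a, j, ha, hns, rfl⟩ := exists_eq_pow_two_pow_not_isSquare N hN
  -- With k = 2^j, the order of a^k is at least (p − 1)/k ≥ p/(2k); the threshold 2·2^k exceeds 2k.
  have hev : ∀ᶠ p : ℕ in Filter.atTop, (2 ^ 2 ^ j * 2 : ℝ) < (p : ℝ) ^ (1 - θ) :=
    ((tendsto_rpow_atTop (by linarith)).comp tendsto_natCast_atTop_atTop).eventually_gt_atTop _
  obtain ⟨p₀, hp₀⟩ := Filter.eventually_atTop.1 hev
  refine ((h a ha hns).sdiff (Set.finite_lt_nat p₀)).mono ?_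
  rintro p ⟨⟨hp, -, hpo⟩, hpp⟩
  have hpp : p₀ ≤ p := not_lt.1 hpp
  refine ⟨hp, ?_⟩
  have hp2 : (2 : ℝ) ≤ p := by exact_mod_cast hp.two_le
  set k := 2 ^ j with hk
  have hk0 : 0 < k := by positivity
  have hpos : 0 < orderOf (a : ZMod p) := by rw [hpo]; have := hp.two_le; omega
  have hpos' : 0 < orderOf ((a : ZMod p) ^ k) :=
    Nat.pos_of_dvd_of_pos (orderOf_pow_dvd k) hpos
  have hle : p - 1 ≤ k * orderOf ((a : ZMod p) ^ k) := by
    rw [← hpo]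
    refine Nat.le_of_dvd (by positivity) (orderOf_dvd_of_pow_eq_one ?_)
    rw [pow_mul, pow_orderOf_eq_one]
  have hle' : (p : ℝ) - 1 ≤ k * orderOf ((a : ZMod p) ^ k) := by
    have h1 : p ≤ k * orderOf ((a : ZMod p) ^ k) + 1 := by omega
    have h2 : (p : ℝ) ≤ ((k * orderOf ((a : ZMod p) ^ k) + 1 : ℕ) : ℝ) := by exact_mod_cast h1
    push_cast at h2
    linarith
  rw [Nat.cast_pow]
  have hkk : (k : ℝ) ≤ 2 ^ k := by exact_mod_cast Nat.lt_two_pow_self.le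
  have hmul : (p : ℝ) ^ θ * (2 ^ k * 2) ≤ p := by
    calc (p : ℝ) ^ θ * (2 ^ k * 2) ≤ (p : ℝ) ^ θ * (p : ℝ) ^ (1 - θ) := by
          gcongr
          exact (hp₀ p hpp).le
      _ = p := by
          rw [← Real.rpow_add (by linarith)]
          simp
  have hkpos : (0 : ℝ) < k := by exact_mod_cast hk0
  have hθp : (0 : ℝ) ≤ (p : ℝ) ^ θ := by positivity
  have h3 : (k : ℝ) * (p : ℝ) ^ θ ≤ k * orderOf ((a : ZMod p) ^ k) := by
    nlinarith
  exact le_of_mul_le_mul_left h3 hkpos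

/-! ### Large multiplicative orders from the Elliott–Halberstam conjecture -/

/-- Chebyshev's bounds: ψ(n) ≤ π(n) log n, while ψ(n) is at least n log 2 up to a lower-order term,
and 1/2 < log 2. -/
theorem eventually_le_primeCounting_mul_log :
    ∀ᶠ n : ℕ in Filter.atTop, (n : ℝ) / 2 ≤ Nat.primeCounting n * Real.log n := by
  have h1 : ∀ᶠ x : ℝ in Filter.atTop, Real.log x ≤ 1 / 20 * x := by
    have := Real.isLittleO_log_id_atTop.bound (by norm_num : (0 : ℝ) < 1 / 20)
    filter_upwards [this, Filter.eventually_ge_atTop 1] with x hx hx1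
    rw [id, Real.norm_of_nonneg (Real.log_nonneg hx1), Real.norm_of_nonneg (by linarith)] at hx
    exact hx
  have h2 := tendsto_natCast_atTop_atTop (R := ℝ)
  filter_upwards [(Filter.tendsto_atTop_add_const_right _ (1 : ℝ) h2).eventually h1,
    Filter.eventually_ge_atTop 1] with n hn hn1
  have hn1 : (1 : ℝ) ≤ n := by exact_mod_cast hn1
  have h3 := Chebyshev.psi_ge n
  have h4 := Chebyshev.psi_le_primeCounting_mul_log n
  have h5 := Real.log_two_gt_d9
  nlinarith

theorem primeCountingAP_eq_card (X q : ℕ) [DecidablePred fun p : ℕ => (p : ℤ) ≡ 1 [ZMOD q]] :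
    primeCountingAP X q 1 =
      ((Finset.range (X + 1)).filter fun p : ℕ => p.Prime ∧ (p : ℤ) ≡ 1 [ZMOD q]).card := by
  rw [primeCountingAP, ← Set.ncard_coe_finset]
  congr 1
  ext p
  simp only [Finset.coe_filter, Finset.mem_range, Nat.lt_succ_iff, Nat.cast_le, Set.mem_ofPred_eq]
  tauto

theorem primeCountingAP_le {x y : ℝ} (hyx : y ≤ x) (q : ℕ) (a : ℤ) :
    primeCountingAP y q a ≤ ⌊x⌋₊ + 1 := by
  classical
  rw [primeCountingAP, ← Finset.card_range (⌊x⌋₊ + 1), ← Set.ncard_coe_finset]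
  refine Set.ncard_le_ncard (fun p hp => ?_) (Finset.finite_toSet _)
  simp only [Finset.coe_range, Set.mem_Iio, Nat.lt_succ_iff]
  exact Nat.le_floor (hp.2.1.trans hyx)

theorem apError_nonneg (x : ℝ) (q : ℕ) : 0 ≤ apError x q :=
  Real.sSup_nonneg fun _ ⟨_, _, _, _, hr⟩ => hr ▸ abs_nonneg _

theorem sub_le_apError (X : ℕ) {q : ℕ} (hq : 0 < q) :
    (Nat.primeCounting X : ℝ) / Nat.totient q - primeCountingAP X q 1 ≤ apError X q := by
  have hφ : (1 : ℝ) ≤ Nat.totient q := by exact_mod_cast Nat.totient_pos.2 hq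
  -- `sSup` is 0 on sets not bounded above, so a bound is needed before y = X, a = 1 can be
  -- inserted.
  have hbdd : BddAbove {r : ℝ | ∃ (y : ℝ) (a : ℤ), y ≤ X ∧ IsCoprime a (q : ℤ) ∧
      r = |(primeCountingAP y q a : ℝ) - (Nat.primeCounting ⌊y⌋₊ : ℝ) / (Nat.totient q : ℝ)|} := by
    refine ⟨(X + 1) + Nat.primeCounting X, ?_⟩
    rintro r ⟨y, a, hy, -, rfl⟩
    have h1 : (primeCountingAP y q a : ℝ) ≤ X + 1 := by
      have := primeCountingAP_le hy q a
      rw [Nat.floor_natCast] at this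
      exact_mod_cast this
    have h2 : (Nat.primeCounting ⌊y⌋₊ : ℝ) ≤ Nat.primeCounting X := by
      refine Nat.cast_le.2 (Nat.monotone_primeCounting ?_)
      rw [← Nat.floor_natCast (R := ℝ) X]
      exact Nat.floor_le_floor hy
    have h3 : (Nat.primeCounting ⌊y⌋₊ : ℝ) / Nat.totient q ≤ Nat.primeCounting X :=
      (div_le_self (by positivity) hφ).trans h2
    have h4 : (0 : ℝ) ≤ (Nat.primeCounting ⌊y⌋₊ : ℝ) / Nat.totient q := by positivity
    rw [abs_le]
    constructor <;> linarith [Nat.cast_nonneg (α := ℝ) (primeCountingAP y q a),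
      Nat.cast_nonneg (α := ℝ) (Nat.primeCounting X), Nat.cast_nonneg (α := ℝ) X]
  have h := le_csSup hbdd ⟨X, 1, le_rfl, isCoprime_one_left, rfl⟩
  rw [Nat.floor_natCast] at h
  refine le_trans ?_ h
  rw [abs_sub_comm]
  exact le_abs_self _

/-! ### Primes p for which p − 1 has a large prime factor -/

open Classical in
/-- The primes `p ≤ X` such that `p - 1` has a prime factor larger than `X ^ α`. -/
noncomputable def primesWithLargeFactor (α : ℝ) (X : ℕ) : Finset ℕ :=
  (Finset.range (X + 1)).filter fun p => p.Prime ∧ ∃ q : ℕ, q.Prime ∧ (X : ℝ) ^ α < q ∧ q ∣ p - 1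

theorem int_modEq_one_iff {p q : ℕ} (hp : 1 ≤ p) : (p : ℤ) ≡ 1 [ZMOD q] ↔ q ∣ p - 1 := by
  rw [Int.modEq_comm, Int.modEq_iff_dvd, ← Int.natCast_dvd_natCast, Nat.cast_sub hp, Nat.cast_one]

-- As α > 1/2, no p ≤ X has two distinct prime factors of p − 1 above X^α, so each p is counted at
-- most once.
open Classical in
theorem sum_primeCountingAP_le {α : ℝ} (hα : 1 / 2 < α) {X : ℕ} (hX : 1 ≤ X) (s : Finset ℕ)
    (hs : ∀ q ∈ s, q.Prime ∧ (X : ℝ) ^ α < q) :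
    ∑ q ∈ s, primeCountingAP X q 1 ≤ (primesWithLargeFactor α X).card := by
  have hX1 : (1 : ℝ) ≤ X := by exact_mod_cast hX
  simp_rw [primeCountingAP_eq_card]
  rw [← Finset.card_biUnion]
  · refine Finset.card_le_card fun p hp => ?_
    simp only [Finset.mem_biUnion, Finset.mem_filter] at hp
    obtain ⟨q, hq, hpX, hpp, hmod⟩ := hp
    exact Finset.mem_filter.2 ⟨hpX, hpp, q, (hs q hq).1, (hs q hq).2,
      (int_modEq_one_iff hpp.one_le).1 hmod⟩
  · intro q hq q' hq' hne
    rw [Function.onFun, Finset.disjoint_left]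
    intro p hp hp'
    simp only [Finset.mem_filter, Finset.mem_range] at hp hp'
    have h1 := (int_modEq_one_iff hp.2.1.one_le).1 hp.2.2
    have h2 := (int_modEq_one_iff hp.2.1.one_le).1 hp'.2.2
    have h3 : q * q' ∣ p - 1 :=
      ((Nat.coprime_primes (hs q hq).1 (hs q' hq').1).2 hne).mul_dvd_of_dvd_of_dvd h1 h2
    have h4 : q * q' ≤ p - 1 := Nat.le_of_dvd (by have := hp.2.1.two_le; omega) h3
    have h5 : ((q * q' : ℕ) : ℝ) ≤ X := by exact_mod_cast h4.trans (by omega)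
    have h6 : (X : ℝ) ≤ (X : ℝ) ^ α * (X : ℝ) ^ α := by
      rw [← Real.rpow_add (by linarith)]
      exact Real.self_le_rpow_of_one_le hX1 (by linarith)
    have h7 : (X : ℝ) ^ α * (X : ℝ) ^ α < q * q' :=
      mul_lt_mul'' (hs q hq).2 (hs q' hq').2 (by positivity) (by positivity)
    push_cast at h5
    linarith

theorem ElliottHalberstamConjecture.eventually_le_card (h : ElliottHalberstamConjecture) {α : ℝ}
    (hα : 1 / 2 < α) (hα1 : α < 1) :
    ∀ᶠ X : ℕ in Filter.atTop,
      (X : ℝ) / 32 ≤ (primesWithLargeFactor α X).card * Real.log X ^ 2 := by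
  classical
  -- Moduli q are the primes in (X^α, X^β], still within the range of the conjecture since β < 1.
  -- There are at least X^β/(8 log X) of them.
  set β := (1 + α) / 2 with hβ
  have hβ0 : 0 < β := by linarith
  have hβ1 : β < 1 := by linarith
  have hαβ : α < β := by linarith
  -- The main term is of size X/log² X, so a saving of log⁴ X leaves room for the constant C.
  obtain ⟨C, hC0, hC⟩ := h β hβ0 hβ1 4 (by norm_num)
  have hcast := tendsto_natCast_atTop_atTop (R := ℝ)
  have hpow : Filter.Tendsto (fun X : ℕ => (X : ℝ) ^ β) Filter.atTop Filter.atTop :=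
    (tendsto_rpow_atTop hβ0).comp hcast
  have hfloor : Filter.Tendsto (fun X : ℕ => ⌊(X : ℝ) ^ β⌋₊) Filter.atTop Filter.atTop :=
    tendsto_nat_floor_atTop.comp hpow
  have hloglim : Filter.Tendsto (fun X : ℕ => Real.log X) Filter.atTop Filter.atTop :=
    Real.tendsto_log_atTop.comp hcast
  have hlogα : ∀ᶠ X : ℕ in Filter.atTop, Real.log X ≤ 1 / 8 * (X : ℝ) ^ (β - α) := by
    have h1 := (isLittleO_log_rpow_atTop (sub_pos.2 hαβ)).bound (by norm_num : (0 : ℝ) < 1 / 8)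
    filter_upwards [hcast.eventually h1, Filter.eventually_ge_atTop 1] with X hX hX1
    have hX1 : (1 : ℝ) ≤ X := by exact_mod_cast hX1
    rwa [Real.norm_of_nonneg (Real.log_nonneg hX1), Real.norm_of_nonneg (by positivity)] at hX
  filter_upwards [eventually_le_primeCounting_mul_log,
    hfloor.eventually eventually_le_primeCounting_mul_log, hlogα,
    hloglim.eventually_ge_atTop (1 + 32 * C), hpow.eventually_ge_atTop 2,
    Filter.eventually_gt_atTop 2] with X hπX hπY hlog hlogC hXβ hX2
  set x : ℝ := (X : ℝ) with hx
  set Y := ⌊x ^ β⌋₊ with hY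
  have hx2 : 2 < x := by rw [hx]; exact_mod_cast hX2
  have hlog1 : 1 ≤ Real.log x := by linarith
  have hYle : (Y : ℝ) ≤ x ^ β := Nat.floor_le (by positivity)
  have hYge : x ^ β / 2 ≤ Y := by
    have := Nat.lt_floor_add_one (x ^ β)
    rw [← hY] at this
    linarith
  have hY1 : (1 : ℝ) ≤ Y := by linarith
  have hYx : (Y : ℝ) ≤ x := hYle.trans (Real.rpow_le_self_of_one_le (by linarith) hβ1.le)
  let s : Finset ℕ := (Finset.Icc 1 Y).filter fun q => q.Prime ∧ x ^ α < q
  have hs : ∀ q ∈ s, q.Prime ∧ x ^ α < q := fun q hq => (Finset.mem_filter.1 hq).2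
  have hscard : (Nat.primeCounting Y : ℝ) ≤ s.card + x ^ α := by
    have h1 : Nat.primesLE Y ⊆ s ∪ Finset.Icc 1 ⌊x ^ α⌋₊ := by
      intro q hq
      have hqp := Nat.prime_of_mem_primesLE hq
      have hqY : q ≤ Y := (Nat.mem_primesLE.1 hq).1
      rw [Finset.mem_union]
      rcases lt_or_ge (x ^ α) q with h2 | h2
      · exact Or.inl (Finset.mem_filter.2 ⟨Finset.mem_Icc.2 ⟨hqp.one_le, hqY⟩, hqp, h2⟩)
      · exact Or.inr (Finset.mem_Icc.2 ⟨hqp.one_le, Nat.le_floor h2⟩)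
    have h2 := (Finset.card_le_card h1).trans (Finset.card_union_le _ _)
    rw [Nat.primesLE_card_eq_primeCounting, Nat.card_Icc, Nat.add_sub_cancel] at h2
    have h3 : (Nat.primeCounting Y : ℝ) ≤ s.card + ⌊x ^ α⌋₊ := by exact_mod_cast h2
    have h4 : (⌊x ^ α⌋₊ : ℝ) ≤ x ^ α := Nat.floor_le (by positivity)
    linarith
  have hαlog : x ^ α * Real.log x ≤ x ^ β / 8 := by
    calc x ^ α * Real.log x ≤ x ^ α * (1 / 8 * x ^ (β - α)) := by gcongr
      _ = (x ^ α * x ^ (β - α)) / 8 := by ring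
      _ = x ^ β / 8 := by
          rw [← Real.rpow_add (by linarith)]
          ring_nf
  have hslog : x ^ β / 8 ≤ s.card * Real.log x := by
    have h1 : Nat.primeCounting Y * Real.log Y ≤ Nat.primeCounting Y * Real.log x := by
      gcongr
    have h2 : Nat.primeCounting Y * Real.log x ≤ (s.card + x ^ α) * Real.log x := by gcongr
    linarith
  have hterm : ∀ q ∈ s, (Nat.primeCounting X : ℝ) / x ^ β - apError x q ≤ primeCountingAP x q 1 := by
    intro q hq
    have hqp := (hs q hq).1
    have h1 := sub_le_apError X hqp.pos
    -- The crude bound φ(q) ≤ X^β loses a logarithm, which is harmless against the power saving used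
    -- later.
    have h2 : (Nat.primeCounting X : ℝ) / x ^ β ≤ Nat.primeCounting X / Nat.totient q := by
      have h3 : (0 : ℝ) < Nat.totient q := by exact_mod_cast Nat.totient_pos.2 hqp.pos
      have h4 : (Nat.totient q : ℝ) ≤ x ^ β := by
        refine le_trans ?_ hYle
        exact_mod_cast (Nat.totient_le q).trans (Finset.mem_Icc.1 (Finset.mem_filter.1 hq).1).2
      gcongr
    rw [← hx] at h1
    linarith
  have herr : ∑ q ∈ s, apError x q ≤ C * x / Real.log x ^ 4 := by
    have h1 := hC x hx2
    have h2 : Real.log x ^ (4 : ℝ) = Real.log x ^ 4 := by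
      exact_mod_cast Real.rpow_natCast (Real.log x) 4
    rw [h2] at h1
    exact (Finset.sum_le_sum_of_subset_of_nonneg (Finset.filter_subset _ _)
      fun q _ _ => apError_nonneg x q).trans h1
  have hsum : (s.card : ℝ) * (Nat.primeCounting X / x ^ β) - C * x / Real.log x ^ 4
      ≤ (primesWithLargeFactor α X).card := by
    have h1 := Finset.sum_le_sum hterm
    rw [Finset.sum_sub_distrib, Finset.sum_const, nsmul_eq_mul] at h1
    have h2 : ((∑ q ∈ s, primeCountingAP x q 1 : ℕ) : ℝ) ≤ (primesWithLargeFactor α X).card := by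
      exact_mod_cast sum_primeCountingAP_le hα (by omega) s hs
    push_cast at h2
    linarith
  have hxβ : 0 < x ^ β := by positivity
  have hmain : x / 16 ≤ (s.card : ℝ) * (Nat.primeCounting X / x ^ β) * Real.log x ^ 2 := by
    calc x / 16 = (x ^ β / 8) * (x / 2) / x ^ β := by field_simp; norm_num
      _ ≤ (s.card * Real.log x) * (Nat.primeCounting X * Real.log x) / x ^ β := by gcongr
      _ = _ := by ring
  have hErr : C * x / Real.log x ^ 4 * Real.log x ^ 2 ≤ x / 32 := by
    have h1 : C * x / Real.log x ^ 4 * Real.log x ^ 2 = C * x / Real.log x ^ 2 := by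
      field_simp
    rw [h1, div_le_iff₀ (by positivity)]
    have h2 : 32 * C ≤ Real.log x ^ 2 := by nlinarith
    nlinarith
  have h9 := mul_le_mul_of_nonneg_right hsum (sq_nonneg (Real.log x))
  rw [sub_mul] at h9
  linarith

/-- With ω prime factors, 2^ω is at most their product, which is below N^k ≤ 2^{Nk}. -/
theorem card_primeFactors_pow_sub_one_le {N : ℕ} (hN : 2 ≤ N) {k : ℕ} (hk : 0 < k) :
    (N ^ k - 1).primeFactors.card ≤ N * k := by
  have h0 : N ^ k - 1 ≠ 0 := by
    have := Nat.one_lt_pow hk.ne' (by omega : 1 < N)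
    omega
  have h1 : 2 ^ (N ^ k - 1).primeFactors.card ≤ ∏ p ∈ (N ^ k - 1).primeFactors, p :=
    Finset.pow_card_le_prod _ _ _ fun p hp => (Nat.prime_of_mem_primeFactors hp).two_le
  have h2 := Nat.le_of_dvd (Nat.pos_of_ne_zero h0) (Nat.prod_primeFactors_dvd (N ^ k - 1))
  have h3 : N ^ k ≤ 2 ^ (N * k) := by
    rw [pow_mul]
    exact Nat.pow_le_pow_left Nat.lt_two_pow_self.le k
  exact (Nat.pow_le_pow_iff_right (by norm_num)).1 (h1.trans (h2.trans (by omega)))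

/-- An order d ≤ X^α is not divisible by the prime q > X^α. Both divide p − 1, so dq ≤ p − 1 and d ≤
X^{1−α}. Such a p is a prime factor of N^d − 1, and these are counted by d. The bound on N ensures N
< p. -/
theorem card_filter_orderOf_lt_le {N : ℕ} (hN : 2 ≤ N) {α : ℝ} {X : ℕ} (hXN : (N : ℝ) ≤ (X : ℝ) ^ α) :
    (((primesWithLargeFactor α X).filter fun p => (orderOf (N : ZMod p) : ℝ) ≤ (X : ℝ) ^ α).card : ℝ)
      ≤ N * (X : ℝ) ^ (2 * (1 - α)) := by
  classical
  set K := ⌊(X : ℝ) ^ (1 - α)⌋₊ with hK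
  have hsub : (primesWithLargeFactor α X).filter (fun p => (orderOf (N : ZMod p) : ℝ) ≤ (X : ℝ) ^ α)
      ⊆ (Finset.Icc 1 K).biUnion fun k => (N ^ k - 1).primeFactors := by
    intro p hp
    simp only [primesWithLargeFactor, Finset.mem_filter, Finset.mem_range] at hp
    obtain ⟨⟨hpX, hpp, q, hqp, hq, hqd⟩, hord⟩ := hp
    have := Fact.mk hpp
    have hX0 : (0 : ℝ) < X := by
      have := hpp.two_le
      exact_mod_cast (by omega : 0 < X)
    have hqle : q ≤ p - 1 := Nat.le_of_dvd (by have := hpp.two_le; omega) hqd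
    have hNp : (N : ZMod p) ≠ 0 := by
      rw [Ne, ZMod.natCast_eq_zero_iff]
      intro hd
      have h1 : p ≤ N := Nat.le_of_dvd (by omega) hd
      have h2 : (p : ℝ) ≤ N := by exact_mod_cast h1
      have h3 : (q : ℝ) ≤ p := by exact_mod_cast hqle.trans (Nat.sub_le _ _)
      linarith
    have hdvd : orderOf (N : ZMod p) ∣ p - 1 := ZMod.orderOf_dvd_card_sub_one hNp
    have hpos : 0 < orderOf (N : ZMod p) :=
      Nat.pos_of_dvd_of_pos hdvd (by have := hpp.two_le; omega)
    have hnd : ¬ q ∣ orderOf (N : ZMod p) := by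
      intro hd
      have h1 : (q : ℝ) ≤ orderOf (N : ZMod p) := by exact_mod_cast Nat.le_of_dvd hpos hd
      linarith
    have hmul : orderOf (N : ZMod p) * q ≤ p - 1 :=
      Nat.le_of_dvd (by have := hpp.two_le; omega)
        (((hqp.coprime_iff_not_dvd.2 hnd).symm).mul_dvd_of_dvd_of_dvd hdvd hqd)
    have hle : (orderOf (N : ZMod p) : ℝ) ≤ (X : ℝ) ^ (1 - α) := by
      have h1 : ((orderOf (N : ZMod p) * q : ℕ) : ℝ) ≤ X := by
        exact_mod_cast hmul.trans (by omega)
      push_cast at h1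
      rw [Real.rpow_sub hX0, Real.rpow_one, le_div_iff₀ (by positivity)]
      exact (mul_le_mul_of_nonneg_left hq.le (by positivity)).trans h1
    rw [Finset.mem_biUnion]
    refine ⟨orderOf (N : ZMod p), Finset.mem_Icc.2 ⟨hpos, Nat.le_floor hle⟩, ?_⟩
    have hlt := Nat.one_lt_pow hpos.ne' (by omega : 1 < N)
    rw [Nat.mem_primeFactors]
    refine ⟨hpp, ?_, by omega⟩
    rw [← ZMod.natCast_eq_zero_iff, Nat.cast_sub hlt.le, Nat.cast_pow, pow_orderOf_eq_one,
      Nat.cast_one, sub_self]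
  have hcard : ((primesWithLargeFactor α X).filter
      fun p => (orderOf (N : ZMod p) : ℝ) ≤ (X : ℝ) ^ α).card ≤ N * (K * K) := by
    refine (Finset.card_le_card hsub).trans (Finset.card_biUnion_le.trans ?_)
    calc ∑ k ∈ Finset.Icc 1 K, (N ^ k - 1).primeFactors.card
        ≤ ∑ k ∈ Finset.Icc 1 K, N * K := by
          refine Finset.sum_le_sum fun k hk => ?_
          rw [Finset.mem_Icc] at hk
          exact (card_primeFactors_pow_sub_one_le hN hk.1).trans (Nat.mul_le_mul_left _ hk.2)
      _ = N * (K * K) := by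
          rw [Finset.sum_const, Nat.card_Icc, smul_eq_mul]
          simp only [Nat.add_sub_cancel]
          ring
  have hKle : (K : ℝ) ≤ (X : ℝ) ^ (1 - α) := Nat.floor_le (by positivity)
  calc _ ≤ ((N * (K * K) : ℕ) : ℝ) := by exact_mod_cast hcard
    _ = N * ((K : ℝ) * K) := by push_cast; rfl
    _ ≤ N * ((X : ℝ) ^ (1 - α) * (X : ℝ) ^ (1 - α)) := by gcongr
    _ = N * (X : ℝ) ^ (2 * (1 - α)) := by
        rw [← sq, ← Real.rpow_natCast, ← Real.rpow_mul (by positivity)]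
        norm_num [mul_comm]

theorem ElliottHalberstamConjecture.infinite_rpow_le_orderOf (h : ElliottHalberstamConjecture)
    {N : ℕ} (hN : 2 ≤ N) {θ : ℝ} (hθ1 : θ < 1) :
    {p : ℕ | p.Prime ∧ (p : ℝ) ^ θ ≤ orderOf (N : ZMod p)}.Infinite := by
  classical
  -- Any value above 1/2 would serve in place of 2/3: it makes 2(1 − α) < 1, so that primes of small
  -- order are outnumbered.
  set α := max θ (2 / 3) with hα
  have hα1 : α < 1 := max_lt hθ1 (by norm_num)
  have hα2 : 2 / 3 ≤ α := le_max_right _ _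
  rw [Set.infinite_iff_exists_gt]
  intro P
  have hcast := tendsto_natCast_atTop_atTop (R := ℝ)
  have hpow : Filter.Tendsto (fun X : ℕ => (X : ℝ) ^ α) Filter.atTop Filter.atTop :=
    (tendsto_rpow_atTop (by linarith)).comp hcast
  have hlog : ∀ᶠ X : ℕ in Filter.atTop,
      Real.log X ^ (2 : ℝ) ≤ (1 / (64 * N) : ℝ) * (X : ℝ) ^ (2 * α - 1) := by
    have h1 := (isLittleO_log_rpow_rpow_atTop 2 (by linarith : 0 < 2 * α - 1)).bound
      (by positivity : (0 : ℝ) < 1 / (64 * N))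
    filter_upwards [hcast.eventually h1, Filter.eventually_ge_atTop 1] with X hX hX1
    have hX1 : (1 : ℝ) ≤ X := by exact_mod_cast hX1
    rwa [Real.norm_of_nonneg (Real.rpow_nonneg (Real.log_nonneg hX1) _),
      Real.norm_of_nonneg (by positivity)] at hX
  obtain ⟨X, hX, hXl, hXN, hXP, hX2⟩ := ((h.eventually_le_card (by linarith) hα1).and
    (hlog.and ((hpow.eventually_ge_atTop N).and ((hpow.eventually_ge_atTop P).and
      (Filter.eventually_ge_atTop 2))))).exists
  have hX2 : (2 : ℝ) ≤ X := by exact_mod_cast hX2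
  have hlogpos : 0 < Real.log X := Real.log_pos (by linarith)
  rw [Real.rpow_two] at hXl
  have hbad := card_filter_orderOf_lt_le hN hXN
  have hlt : ((primesWithLargeFactor α X).filter
      fun p => (orderOf (N : ZMod p) : ℝ) ≤ (X : ℝ) ^ α).card < (primesWithLargeFactor α X).card := by
    by_contra hc
    have h1 : ((primesWithLargeFactor α X).card : ℝ) ≤ N * (X : ℝ) ^ (2 * (1 - α)) :=
      le_trans (by exact_mod_cast not_lt.1 hc) hbad
    have h2 : (X : ℝ) ^ (2 * (1 - α)) * (X : ℝ) ^ (2 * α - 1) = X := by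
      rw [← Real.rpow_add (by linarith)]
      ring_nf
      simp
    have h3 : (X : ℝ) / 32 ≤ X / 64 := by
      calc (X : ℝ) / 32 ≤ (primesWithLargeFactor α X).card * Real.log X ^ 2 := hX
        _ ≤ (N * (X : ℝ) ^ (2 * (1 - α))) * ((1 / (64 * N) : ℝ) * (X : ℝ) ^ (2 * α - 1)) := by
            gcongr
        _ = ((X : ℝ) ^ (2 * (1 - α)) * (X : ℝ) ^ (2 * α - 1)) / 64 := by
            have : (N : ℝ) ≠ 0 := by positivity
            field_simp
        _ = X / 64 := by rw [h2]
    linarith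
  obtain ⟨p, hp, hpf⟩ := Finset.exists_mem_notMem_of_card_lt_card hlt
  have hord : (X : ℝ) ^ α < orderOf (N : ZMod p) := by
    by_contra hc
    exact hpf (Finset.mem_filter.2 ⟨hp, not_lt.1 hc⟩)
  simp only [primesWithLargeFactor, Finset.mem_filter, Finset.mem_range] at hp
  obtain ⟨hpX, hpp, q, hqp, hq, hqd⟩ := hp
  have hqle : q ≤ p - 1 := Nat.le_of_dvd (by have := hpp.two_le; omega) hqd
  have hp1 : (1 : ℝ) ≤ p := by exact_mod_cast hpp.one_le
  refine ⟨p, ⟨hpp, le_trans ?_ hord.le⟩, ?_⟩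
  · calc (p : ℝ) ^ θ ≤ (p : ℝ) ^ α := Real.rpow_le_rpow_of_exponent_le hp1 (le_max_left _ _)
      _ ≤ (X : ℝ) ^ α := by
          gcongr
          omega
  -- The large prime factor q of p − 1 exceeds X^α ≥ P, which makes p itself exceed P.
  · have h1 : (P : ℝ) < q := hXP.trans_lt hq
    have h2 : P < q := by exact_mod_cast h1
    omega

theorem theorem2 (hconj : ArtinPrimitiveRootConjecture ∨ ElliottHalberstamConjecture)
    (N : ℕ) (B L : Finset ℤ) (hT : IsHadamardTriple N B L) (hB0 : (0 : ℤ) ∈ B)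
    (hL0 : (0 : ℤ) ∈ L) :
    (IsSingularContinuous (selfSimilarMeasure N B) ↔ B.card < N) ∧
      (IsSingularContinuous (selfSimilarMeasure N B) →
        {p : ℕ | p.Prime ∧ IsSpectralEigenvalue (selfSimilarMeasure N B)
          (canonicalSpectrum N B L) (p : ℝ)}.Infinite) := by
  have h := hT.hasHadamardSums
  have hiff := isSingularContinuous_selfSimilarMeasure_iff h
  refine ⟨hiff, fun hs => h.infinite_spectralEigenvalue hB0 hL0 (hiff.1 hs) fun θ _ hθ1 => ?_⟩
  rcases hconj with hA | hE
  · exact hA.infinite_rpow_le_orderOf h.two_le hθ1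
  · exact hE.infinite_rpow_le_orderOf h.two_le hθ1
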